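/- Let $\mathcal A$ be a set of actions and $\mathcal F=\{f_\rho:\mathcal A\to\mathbb R\mid\rho\in\Theta\}$ a class of functions with $f_\rho(a)\in[0,C]$ for all $\rho,a$, where $C>0$; let $\sigma>0$. A random variable $\theta$ with values in $\Theta$ indexes the true reward function. In each period $t=1,2,\dots$ the agent sees a (possibly random) set $\mathcal A_t\subseteq\mathcal A$, selects $A_t\in\mathcal A_t$ and observes a reward $R_t$. Let $H_t=(\mathcal A_1,A_1,R_1,\dots,\mathcal A_{t-1},A_{t-1},R_{t-1},\mathcal A_t)$. The action $A_t$ is sampled from a distribution $\pi_t$ that is determined by $H_t$ (so that $\mathbb P(A_t\in\cdot\mid H_t,\theta)=\mathbb P(A_t\in\cdot\mid H_t)=\pi_t$), and $\mathbb E[R_t\mid H_t,\theta,A_t]=f_\theta(A_t)$. Assume that $R_t-f_\theta(A_t)$ is $\sigma$-sub-Gaussian conditionally on $(H_t,\theta,A_t)$, i.e. $\mathbb E[e^{\lambda(R_t-f_\theta(A_t))}\mid H_t,\theta,A_t]\le e^{\lambda^2\sigma^2/2}$ almost surely for all $\lambda\in\mathbb R$. Posterior sampling $\pi^{\rm PS}$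 is the policy $\pi_t=\mathbb P(A_t^*\in\cdot\mid H_t)$, where $A_t^*$ is a random variable with $A_t^*\in\arg\max_{a\in\mathcal A_t}f_\theta(a)$ almost surely. The Bayesian regret is $\mathrm{BayesRegret}(T,\pi)=\sum_{t=1}^T\mathbb E\big[\max_{a\in\mathcal A_t}f_\theta(a)-f_\theta(A_t)\big]$. An action $a$ is $\epsilon$-dependent on $a_1,\dots,a_n$ if all $f,\tilde f\in\mathcal F$ with $\sqrt{\sum_{i=1}^n(f(a_i)-\tilde f(a_i))^2}\le\epsilon$ satisfy $f(a)-\tilde f(a)\le\epsilon$, and $\epsilon$-independent of them otherwise. The eluder dimension $\dim_E(\mathcal F,\epsilon)\in\{0,1,\dots,\infty\}$ is the length of the longest sequence of actions such that, for some $\epsilon'\ge\epsilon$, every element is $\epsilon'$-independent of its predecessors. With $N(\mathcal F,\alpha,\|\cdot\|_\infty)$ the $\alpha$-covering number of $\mathcal F$ in the sup-norm, the Kolmogorov dimension is $\dim_K(\mathcal F)=\limsup_{\alpha\downarrow0}\log N(\mathcal F,\alpha,\|\cdot\|_\infty)/\log(1/\alpha)\in[0,\infty]$. Then there is a sequence $h(T)\to0$,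 which depends only on $\mathcal F$, $C$ and $\sigma$ (and not on the law of $\theta$, of the noise or of the action sets), such that for all integers $T\ge1$ $$\mathrm{BayesRegret}(T,\pi^{\rm PS})\le 1+\big[\dim_E(\mathcal F,T^{-1})+1\big]C+16\sigma\sqrt{\dim_E(\mathcal F,T^{-1})\,\big(1+h(T)+\dim_K(\mathcal F)\big)\,\log(T)\,T},$$ unless both $\dim_E(\mathcal F,T^{-1})=0$ and $\dim_K(\mathcal F)=\infty$, when the product $0\cdot\infty$ under the root has no meaning (at $T=1$, where $\log T=0$, the last term is read as $0$). Further, if $\mathcal F$ is finite, then for all integers $T\ge1$ $$\mathrm{BayesRegret}(T,\pi^{\rm PS})\le 1+\big[\dim_E(\mathcal F,T^{-1})+1\big]C+8\sigma\sqrt{2\dim_E(\mathcal F,T^{-1})\log(2|\mathcal F|T)\,T}.$$ -/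

import Mathlib

open MeasureTheory ProbabilityTheory Filter Topology
open scoped NNReal ENNReal

namespace PosteriorSampling

noncomputable section

/-! ### Complexity of a class of functions -/

/-- `a` is `ε`-dependent on the actions `s 0, …, s (n - 1)` with respect to the class `F`. -/
def EpsDependent {𝒜 : Type*} (F : Set (𝒜 → ℝ)) (ε : ℝ) {n : ℕ} (s : Fin n → 𝒜) (a : 𝒜) : Prop :=
  ∀ f ∈ F, ∀ g ∈ F, √(∑ i, (f (s i) - g (s i)) ^ 2) ≤ ε → f a - g a ≤ ε

/-- Every element of the finite sequence `s` is `ε`-independent of its predecessors. -/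
def IsEluderSeq {𝒜 : Type*} (F : Set (𝒜 → ℝ)) (ε : ℝ) {d : ℕ} (s : Fin d → 𝒜) : Prop :=
  ∀ k : Fin d, ¬ EpsDependent F ε (fun i : Fin (k : ℕ) => s (Fin.castLE k.isLt.le i)) (s k)

/-- The `ε`-eluder dimension: the length of the longest sequence of actions such that, for some
`ε' ≥ ε`, every element is `ε'`-independent of its predecessors (`⊤` if the lengths of such
sequences are unbounded). -/
def eluderDim {𝒜 : Type*} (F : Set (𝒜 → ℝ)) (ε : ℝ) : ℕ∞ :=
  ⨆ (d : ℕ) (_ : ∃ s : Fin d → 𝒜, ∃ ε' : ℝ, ε ≤ ε' ∧ IsEluderSeq F ε' s), (d : ℕ∞)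

/-- The `α`-covering number of `F` in the sup-norm. The distance on `𝒜 →ᵤ ℝ` is
`⨆ a, edist (f a) (g a)`. -/
def supCoveringNumber {𝒜 : Type*} (F : Set (𝒜 → ℝ)) (α : ℝ≥0) : ℕ∞ :=
  Metric.coveringNumber α (UniformFun.ofFun '' F : Set (UniformFun 𝒜 ℝ))

/-- The Kolmogorov dimension `limsup_{α ↓ 0} log N(F, α, ‖·‖_∞) / log (1 / α)`. -/
def kolmogorovDim {𝒜 : Type*} (F : Set (𝒜 → ℝ)) : ℝ≥0∞ :=
  limsup (fun α : ℝ≥0 =>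
      (ENNReal.log (supCoveringNumber F α : ℝ≥0∞)).toENNReal / ENNReal.ofReal (Real.log (1 / α)))
    (𝓝[>] 0)

/-! ### The bandit model -/

/-- The random variables of a bandit problem: the parameter `θ` of the true reward function, and,
for each period, the set of available actions, the selected action and the observed reward.
Periods are numbered from `0`. -/
structure BanditProcess (Ω Θ 𝒜 : Type*) where
  param : Ω → Θ
  actionSet : ℕ → Ω → Set 𝒜
  action : ℕ → Ω → 𝒜
  reward : ℕ → Ω → ℝ

namespace BanditProcess

variable {Ω Θ 𝒜 : Type*}

/-- The σ-algebra generated by the history `H t`, which consists of the action sets of the periods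
`0, …, t` and of the actions and rewards of the periods `0, …, t - 1`. The σ-algebra `mS` is the
one with respect to which the random action sets are random variables. -/
abbrev history [MeasurableSpace 𝒜] (X : BanditProcess Ω Θ 𝒜) (mS : MeasurableSpace (Set 𝒜)) (t : ℕ) :
    MeasurableSpace Ω :=
  (⨆ s ∈ Set.Iic t, MeasurableSpace.comap (X.actionSet s) mS) ⊔
    ⨆ s ∈ Set.Iio t, MeasurableSpace.comap (X.action s) inferInstance ⊔
      MeasurableSpace.comap (X.reward s) inferInstance

/-- The σ-algebra generated by `(H t, θ)`. -/
abbrev historyParam [MeasurableSpace Θ] [MeasurableSpace 𝒜] (X : BanditProcess Ω Θ 𝒜)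
    (mS : MeasurableSpace (Set 𝒜)) (t : ℕ) : MeasurableSpace Ω :=
  X.history mS t ⊔ MeasurableSpace.comap X.param inferInstance

/-- The σ-algebra generated by `(H t, θ, A t)`. -/
abbrev historyParamAction [MeasurableSpace Θ] [MeasurableSpace 𝒜] (X : BanditProcess Ω Θ 𝒜)
    (mS : MeasurableSpace (Set 𝒜)) (t : ℕ) : MeasurableSpace Ω :=
  X.historyParam mS t ⊔ MeasurableSpace.comap (X.action t) inferInstance

/-- The observation noise `R t - f_θ (A t)`. -/
def noise (X : BanditProcess Ω Θ 𝒜) (f : Θ → 𝒜 → ℝ) (t : ℕ) (ω : Ω) : ℝ :=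
  X.reward t ω - f (X.param ω) (X.action t ω)

/-- `X` is a bandit problem with reward functions `f ρ`, `ρ : Θ`: an available action is
selected in every period, by sampling from a distribution determined by the history (so that
the conditional law of `A t` given `(H t, θ)` is its conditional law given `H t`), and
`𝔼[R t | H t, θ, A t] = f_θ (A t)`. -/
structure IsBandit [MeasurableSpace Ω] [MeasurableSpace Θ] [MeasurableSpace 𝒜]
    (X : BanditProcess Ω Θ 𝒜) (mS : MeasurableSpace (Set 𝒜)) (f : Θ → 𝒜 → ℝ) (μ : Measure Ω) :
    Prop where
  measurable_f : Measurable (Function.uncurry f)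
  measurable_param : Measurable X.param
  measurable_actionSet : ∀ t, Measurable[_, mS] (X.actionSet t)
  measurable_action : ∀ t, Measurable (X.action t)
  measurable_reward : ∀ t, Measurable (X.reward t)
  action_mem : ∀ t, ∀ᵐ ω ∂μ, X.action t ω ∈ X.actionSet t ω
  sampled_from_policy : ∀ t, ∀ B : Set 𝒜, MeasurableSet B →
    μ⟦X.action t ⁻¹' B | X.historyParam mS t⟧ =ᵐ[μ] μ⟦X.action t ⁻¹' B | X.history mS t⟧
  mean_reward : ∀ t, μ[X.reward t | X.historyParamAction mS t] =ᵐ[μ]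
    fun ω => f (X.param ω) (X.action t ω)

/-- Conditionally on `(H t, θ, A t)`, the noise `R t - f_θ (A t)` is `σ`-sub-Gaussian. -/
def HasSubGaussianNoise [MeasurableSpace Ω] [MeasurableSpace Θ] [MeasurableSpace 𝒜]
    (X : BanditProcess Ω Θ 𝒜) (mS : MeasurableSpace (Set 𝒜)) (f : Θ → 𝒜 → ℝ) (μ : Measure Ω)
    (σ : ℝ) : Prop :=
  ∀ t, ∀ l : ℝ, Integrable (fun ω => Real.exp (l * X.noise f t ω)) μ ∧
    μ[fun ω => Real.exp (l * X.noise f t ω) | X.historyParamAction mS t] ≤ᵐ[μ]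
      fun _ => Real.exp (l ^ 2 * σ ^ 2 / 2)

/-- The actions are selected by posterior sampling: in every period, the conditional law of `A t`
given `H t` is the conditional law given `H t` of an optimal action, that is, of a random
variable `Astar` with values in `argmax_{a ∈ 𝒜 t} f_θ a`. -/
def IsPosteriorSampling [MeasurableSpace Ω] [MeasurableSpace 𝒜]
    (X : BanditProcess Ω Θ 𝒜) (mS : MeasurableSpace (Set 𝒜)) (f : Θ → 𝒜 → ℝ) (μ : Measure Ω) :
    Prop :=
  ∀ t, ∃ Astar : Ω → 𝒜, Measurable Astar ∧
    (∀ᵐ ω ∂μ, Astar ω ∈ X.actionSet t ω ∧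
      ∀ a ∈ X.actionSet t ω, f (X.param ω) a ≤ f (X.param ω) (Astar ω)) ∧
    ∀ B : Set 𝒜, MeasurableSet B →
      μ⟦X.action t ⁻¹' B | X.history mS t⟧ =ᵐ[μ] μ⟦Astar ⁻¹' B | X.history mS t⟧

/-- The Bayesian regret `∑_t 𝔼[max_{a ∈ 𝒜 t} f_θ a - f_θ (A t)]` over the first `T` periods. -/
def bayesRegret [MeasurableSpace Ω] (X : BanditProcess Ω Θ 𝒜) (f : Θ → 𝒜 → ℝ) (μ : Measure Ω)
    (T : ℕ) : ℝ :=
  ∑ t ∈ Finset.range T,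
    ∫ ω, (sSup (f (X.param ω) '' X.actionSet t ω) - f (X.param ω) (X.action t ω)) ∂μ

end BanditProcess

end

end PosteriorSampling

/-! Take a finite net of the class and, from the history, the set of net functions within empirical
distance `b` of the least squares fits. Let `U` and `L` be the upper and lower envelopes of this
set. Given the history, the selected action `A` and the optimal action `A*` have the same law, and
`U` is determined by the history, so `U(A*)` and `U(A)` have the same expectation
(`integral_comp_eq_of_condLaw_eq`). If the set contains a function `α`-close to the truth, then
`f(A*) - f(A) ≤ 2α + (U(A*) - U(A)) + (U(A) - L(A))`. The middle term has mean zero, so the expected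
regret is at most the expected sum of widths plus small errors.

The set contains such a function with high probability, because the exponential of the scaled loss
gap of a fixed function is a supermartingale (`lintegral_exp_lossGap_le`). A union bound over the
net then covers the random least squares fit.

The sum of widths is bounded on every path (`sum_width_le`). If many actions have width above `ε`,
sorting them greedily into bins gives a bin that is a long eluder sequence. Hence the widths in
decreasing order are at most `C` for the first `d` ranks and `2b√d / √(j+1)` at rank `d + j`, and
they sum to at most `1 + dC + 4b√(dT)`.

A finite class is its own net. In general the net has scale `T⁻²`, and the Kolmogorov dimension
bounds its size. The resulting radius fits the stated constant for all large `T`, so `h` can vanish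
there; below that threshold `h` is only large enough to make the bound trivial. -/

namespace PosteriorSampling

/-! ### Eluder dimension and sums of widths -/

section Eluder

variable {𝒜 : Type*} {F : Set (𝒜 → ℝ)}

/-- The action `a t` is `ε`-independent of the actions `a k`, `k ∈ B`. -/
def EpsIndependentOf (F : Set (𝒜 → ℝ)) (ε : ℝ) (a : ℕ → 𝒜) (B : Finset ℕ) (t : ℕ) : Prop :=
  ∃ f ∈ F, ∃ g ∈ F, √(∑ k ∈ B, (f (a k) - g (a k)) ^ 2) ≤ ε ∧ ε < f (a t) - g (a t)

/-- Listing `B` in increasing order gives an eluder sequence. -/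
lemma card_le_of_eluderDim_le {ε ε' : ℝ} {d : ℕ} (hd : eluderDim F ε ≤ d) (hε : ε ≤ ε')
    (a : ℕ → 𝒜) (B : Finset ℕ)
    (hB : ∀ t ∈ B, EpsIndependentOf F ε' a (B.filter (· < t)) t) : B.card ≤ d := by
  have key : ((B.card : ℕ) : ℕ∞) ≤ eluderDim F ε := by
    refine le_iSup₂_of_le B.card ⟨fun i => a (B.orderEmbOfFin rfl i), ε', hε, fun k hk => ?_⟩ le_rfl
    obtain ⟨f, hf, g, hg, h1, h2⟩ := hB _ (B.orderEmbOfFin_mem rfl k)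
    refine absurd (hk f hf g hg ?_) (not_le.2 h2)
    refine le_trans (Real.sqrt_le_sqrt ?_) h1
    have hinj : Function.Injective
        (fun i : Fin (k : ℕ) => B.orderEmbOfFin rfl (Fin.castLE k.isLt.le i)) :=
      (B.orderEmbOfFin rfl).injective.comp (Fin.castLE_injective _)
    rw [← Finset.sum_image (f := fun j => (f (a j) - g (a j)) ^ 2)
      (s := Finset.univ) (hinj.injOn)]
    refine Finset.sum_le_sum_of_subset_of_nonneg ?_ fun _ _ _ => sq_nonneg _
    intro j hj
    obtain ⟨i, -, rfl⟩ := Finset.mem_image.1 hj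
    refine Finset.mem_filter.2 ⟨B.orderEmbOfFin_mem rfl _, ?_⟩
    exact (B.orderEmbOfFin rfl).strictMono (Fin.lt_def.2 i.isLt)
  exact_mod_cast key.trans hd

/-- Greedy assignment of times to bins, each time to the first bin of which it is independent. -/
lemma exists_greedy_assignment {ε : ℝ} (a : ℕ → 𝒜) (I : Finset ℕ)
    (hI : ∀ t ∈ I, EpsIndependentOf F ε a ∅ t) (n : ℕ) :
    ∃ c : ℕ → ℕ, ∀ t ∈ I, t < n →
      EpsIndependentOf F ε a (I.filter fun k => k < t ∧ c k = c t) t ∧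
      ∀ j < c t, ¬ EpsIndependentOf F ε a (I.filter fun k => k < t ∧ c k = j) t := by
  classical
  induction n with
  | zero => exact ⟨fun _ => 0, fun t _ h => absurd h (Nat.not_lt_zero t)⟩
  | succ n ih =>
    obtain ⟨c, hc⟩ := ih
    by_cases hn : n ∈ I
    · have hex : ∃ j, EpsIndependentOf F ε a (I.filter fun k => k < n ∧ c k = j) n := by
        -- This bin is still empty, so it accepts `n`; hence a first accepting bin exists.
        refine ⟨I.sup c + 1, ?_⟩
        rw [Finset.filter_false_of_mem]
        · exact hI n hn
        · rintro k hk ⟨-, h⟩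
          have := Finset.le_sup (f := c) hk
          omega
      have hfil : ∀ t ≤ n, ∀ j, (I.filter fun k => k < t ∧ Function.update c n (Nat.find hex) k = j)
          = I.filter fun k => k < t ∧ c k = j := by
        intro t ht j
        refine Finset.filter_congr fun k _ => and_congr_right fun hk => ?_
        rw [Function.update_of_ne (by omega)]
      refine ⟨Function.update c n (Nat.find hex), fun t ht htn => ?_⟩
      rw [hfil t (by omega)]
      simp_rw [hfil t (Nat.lt_succ_iff.1 htn)]
      rcases (Nat.lt_succ_iff.1 htn).lt_or_eq with h | rfl
      · rw [Function.update_of_ne h.ne]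
        exact hc t ht h
      · rw [Function.update_self]
        exact ⟨Nat.find_spec hex, fun j hj => Nat.find_min hex hj⟩
    · refine ⟨c, fun t ht htn => hc t ht ?_⟩
      rcases (Nat.lt_succ_iff.1 htn).lt_or_eq with h | rfl
      · exact h
      · exact absurd ht hn

/-- The number of times at which two functions that are close on the past differ by more than `ε`. -/
lemma card_wide_le {ε₀ ε M : ℝ} {d : ℕ} (hM : 0 ≤ M) (hd : eluderDim F ε₀ ≤ d) (hε₀ : ε₀ ≤ ε) (hε : 0 < ε)
    (a : ℕ → 𝒜) (I : Finset ℕ)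
    (hI : ∀ t ∈ I, ∃ f ∈ F, ∃ g ∈ F, ∑ k ∈ Finset.range t, (f (a k) - g (a k)) ^ 2 ≤ M ∧
      ε < f (a t) - g (a t)) :
    (I.card : ℝ) ≤ (M / ε ^ 2 + 1) * d := by
  classical
  obtain ⟨c, hc⟩ := exists_greedy_assignment (F := F) (ε := ε) a I (fun t ht => by
    obtain ⟨f, hf, g, hg, -, h⟩ := hI t ht
    exact ⟨f, hf, g, hg, by simpa using hε.le, h⟩) (I.sup id + 1)
  replace hc := fun t ht => hc t ht (Nat.lt_succ_iff.2 (Finset.le_sup (f := id) ht))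
  -- Every bin before `c t` rejected `t`, so the one pair `f, g` has squared distance above `ε ^ 2`
  -- on each of them. These bins are disjoint parts of the past, whence `c t * ε ^ 2 ≤ M`.
  have hlt : ∀ t ∈ I, c t ∈ Finset.range (⌊M / ε ^ 2⌋₊ + 1) := by
    intro t ht
    rw [Finset.mem_range, Nat.lt_succ_iff, Nat.le_floor_iff (by positivity),
      le_div_iff₀ (by positivity)]
    obtain ⟨f, hf, g, hg, h1, h2⟩ := hI t ht
    refine le_trans ?_ h1
    calc (c t : ℝ) * ε ^ 2 = ∑ j ∈ Finset.range (c t), ε ^ 2 := by simp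
      _ ≤ ∑ j ∈ Finset.range (c t), ∑ k ∈ I.filter (fun k => k < t ∧ c k = j),
            (f (a k) - g (a k)) ^ 2 := by
          refine Finset.sum_le_sum fun j hj => ?_
          have := (hc t ht).2 j (Finset.mem_range.1 hj)
          by_contra! hcon
          exact this ⟨f, hf, g, hg, (Real.sqrt_le_left hε.le).2 hcon.le, h2⟩
      _ ≤ ∑ k ∈ Finset.range t, (f (a k) - g (a k)) ^ 2 := by
          rw [← Finset.sum_biUnion]
          · refine Finset.sum_le_sum_of_subset_of_nonneg ?_ fun _ _ _ => sq_nonneg _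
            intro k hk
            simp only [Finset.mem_biUnion, Finset.mem_filter] at hk
            obtain ⟨j, -, -, hk, -⟩ := hk
            exact Finset.mem_range.2 hk
          · intro i _ j _ hij
            refine Finset.disjoint_left.2 fun k hk hk' => hij ?_
            rw [← (Finset.mem_filter.1 hk).2.2, ← (Finset.mem_filter.1 hk').2.2]
  -- Each bin is an eluder sequence, so it holds at most `d` times.
  have hfib : ∀ j ∈ Finset.range (⌊M / ε ^ 2⌋₊ + 1), (I.filter fun k => c k = j).card ≤ d := by
    intro j _
    refine card_le_of_eluderDim_le hd hε₀ a _ fun t ht => ?_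
    obtain ⟨htI, rfl⟩ := Finset.mem_filter.1 ht
    convert (hc t htI).1 using 1
    rw [Finset.filter_filter]
    exact Finset.filter_congr fun k _ => and_comm
  have hcard := Finset.card_le_mul_card_image_of_maps_to hlt d hfib
  rw [Finset.card_range] at hcard
  calc (I.card : ℝ) ≤ (d * (⌊M / ε ^ 2⌋₊ + 1) : ℕ) := by exact_mod_cast hcard
    _ = ((⌊M / ε ^ 2⌋₊ : ℝ) + 1) * d := by push_cast; ring
    _ ≤ (M / ε ^ 2 + 1) * d := by
        gcongr
        exact Nat.floor_le (by positivity)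

/-- A sum is bounded through the ranks of its terms. -/
lemma sum_le_sum_range_of_rank {ι : Type*} (I : Finset ι) (w : ι → ℝ) (φ : ℕ → ℝ)
    (h : ∀ t ∈ I, ∀ i < (I.filter fun s => w t ≤ w s).card, w t ≤ φ i) :
    ∑ t ∈ I, w t ≤ ∑ i ∈ Finset.range I.card, φ i := by
  classical
  -- The smallest term has the last rank, and removing it does not raise the rank of any other term.
  induction I using Finset.induction_on_min_value w with
  | empty => simp
  | insert m s hm hmin ih =>
    rw [Finset.sum_insert hm, Finset.card_insert_of_notMem hm, Finset.sum_range_succ, add_comm]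
    refine add_le_add (ih fun t ht i hi => h t (Finset.mem_insert_of_mem ht) i
      (hi.trans_le (Finset.card_le_card (Finset.filter_subset_filter _ (Finset.subset_insert _ _)))))
      (h m (Finset.mem_insert_self _ _) _ ?_)
    rw [Finset.filter_true_of_mem, Finset.card_insert_of_notMem hm]
    · exact Nat.lt_succ_self _
    · intro x hx
      rcases Finset.mem_insert.1 hx with rfl | hx
      · exact le_rfl
      · exact hmin x hx

lemma sum_inv_sqrt_le (n : ℕ) : ∑ j ∈ Finset.range n, (√((j : ℝ) + 1))⁻¹ ≤ 2 * √n := by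
  induction n with
  | zero => simp
  | succ n ih =>
    rw [Finset.sum_range_succ]
    have h1 : 0 < √((n : ℝ) + 1) := Real.sqrt_pos.2 (by positivity)
    have h2 : √((n : ℝ) + 1) ^ 2 = n + 1 := Real.sq_sqrt (by positivity)
    have h3 : √(n : ℝ) ^ 2 = n := Real.sq_sqrt (by positivity)
    have h4 : (√((n : ℝ) + 1))⁻¹ ≤ 2 * (√((n : ℝ) + 1) - √n) := by
      rw [inv_le_iff_one_le_mul₀ h1]
      nlinarith [sq_nonneg (√((n : ℝ) + 1) - √n)]
    push_cast
    linarith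

/-- Sum of the widths of confidence sets along a sequence of actions. -/
lemma sum_width_le {T d : ℕ} {C b : ℝ} (hT : 1 ≤ T) (hC : 0 ≤ C) (hb : 0 ≤ b)
    (hd : eluderDim F (T : ℝ)⁻¹ ≤ d) (a : ℕ → 𝒜) (w : ℕ → ℝ) (hwC : ∀ t < T, w t ≤ C)
    (hw : ∀ t < T, ∀ ε, 0 < ε → ε < w t → ∃ f ∈ F, ∃ g ∈ F,
      ∑ k ∈ Finset.range t, (f (a k) - g (a k)) ^ 2 ≤ (2 * b) ^ 2 ∧ ε < f (a t) - g (a t)) :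
    ∑ t ∈ Finset.range T, w t ≤ 1 + d * C + 4 * b * √(d * T) := by
  have hT0 : (0 : ℝ) < T := by exact_mod_cast hT
  have hT' : (0 : ℝ) < (T : ℝ)⁻¹ := by positivity
  -- Widths up to `1 / T` add at most 1 in all; larger ones are at a scale that the eluder dimension
  -- at `1 / T` controls.
  rw [← Finset.sum_filter_add_sum_filter_not (Finset.range T) (fun t => w t ≤ (T : ℝ)⁻¹), add_assoc]
  refine add_le_add ?_ ?_
  · calc ∑ t ∈ (Finset.range T).filter (fun t => w t ≤ (T : ℝ)⁻¹), w t
        ≤ ∑ t ∈ (Finset.range T).filter (fun t => w t ≤ (T : ℝ)⁻¹), (T : ℝ)⁻¹ :=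
          Finset.sum_le_sum fun t ht => (Finset.mem_filter.1 ht).2
      _ ≤ ∑ t ∈ Finset.range T, (T : ℝ)⁻¹ :=
          Finset.sum_le_sum_of_subset_of_nonneg (Finset.filter_subset _ _) fun _ _ _ => hT'.le
      _ = 1 := by simp [hT0.ne']
  · set I := (Finset.range T).filter (fun t => ¬ w t ≤ (T : ℝ)⁻¹) with hI
    have hIT : I.card ≤ T := (Finset.card_filter_le _ _).trans (Finset.card_range T).le
    have hmem : ∀ t ∈ I, t < T ∧ (T : ℝ)⁻¹ < w t := fun t ht => by
      simpa [hI] using ht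
    let ψ : ℕ → ℝ := fun j => 2 * b * √d * (√((j : ℝ) + 1))⁻¹
    let φ : ℕ → ℝ := fun i => if i < d then C else ψ (i - d)
    have hψ : ∀ j, 0 ≤ ψ j := fun j => by positivity
    have hφ : ∀ i, 0 ≤ φ i := fun i => by
      by_cases h : i < d
      · simpa [φ, h] using hC
      · simpa [φ, h] using hψ _
    calc ∑ t ∈ I, w t ≤ ∑ i ∈ Finset.range I.card, φ i := by
          refine sum_le_sum_range_of_rank I w φ fun t ht i hi => ?_
          obtain ⟨htT, hwt⟩ := hmem t ht
          by_cases hid : i < d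
          · simpa [φ, hid] using hwC t htT
          simp only [φ, hid, if_false, ψ]
          -- At least `i + 1` times have width above `ε`, so `i + 1 ≤ ((2b)² / ε² + 1) d`; solve for
          -- `ε`. The claim for `w t` itself follows by letting `ε` increase to it.
          have hbound : ∀ ε, (T : ℝ)⁻¹ ≤ ε → ε < w t →
              ε * √(((i - d : ℕ) : ℝ) + 1) ≤ 2 * b * √d := by
            intro ε h1 h2
            have hε : 0 < ε := hT'.trans_le h1
            have := card_wide_le (sq_nonneg (2 * b)) hd h1 hε a
              (I.filter fun s => w t ≤ w s) (fun s hs => by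
                obtain ⟨hsI, hs⟩ := Finset.mem_filter.1 hs
                exact hw s (hmem s hsI).1 ε hε (h2.trans_le hs))
            have hi' : (i : ℝ) + 1 ≤ (I.filter fun s => w t ≤ w s).card := by exact_mod_cast hi
            have h3 : (i : ℝ) + 1 ≤ ((2 * b) ^ 2 / ε ^ 2 + 1) * d := hi'.trans this
            have h4 : ε ^ 2 * (((i - d : ℕ) : ℝ) + 1) ≤ (2 * b) ^ 2 * d := by
              rw [Nat.cast_sub (not_lt.1 hid)]
              have h5 : (i : ℝ) - d + 1 ≤ (2 * b) ^ 2 / ε ^ 2 * d := by linarith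
              calc ε ^ 2 * ((i : ℝ) - d + 1) ≤ ε ^ 2 * ((2 * b) ^ 2 / ε ^ 2 * d) := by gcongr
                _ = (2 * b) ^ 2 * d := by field_simp
            have h6 := Real.sqrt_le_sqrt h4
            rwa [Real.sqrt_mul (by positivity), Real.sqrt_mul (by positivity),
              Real.sqrt_sq hε.le, Real.sqrt_sq (by positivity)] at h6
          have hpos : 0 < √(((i - d : ℕ) : ℝ) + 1) := Real.sqrt_pos.2 (by positivity)
          rw [← div_eq_mul_inv, le_div_iff₀ hpos]
          by_contra! hcon
          rw [← div_lt_iff₀ hpos] at hcon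
          obtain ⟨ε, h1, h2⟩ := exists_between (max_lt hcon hwt)
          have := hbound ε ((le_max_right _ _).trans h1.le) h2
          rw [← le_div_iff₀ hpos] at this
          exact absurd ((le_max_left _ _).trans_lt h1) (not_lt.2 this)
      _ ≤ ∑ i ∈ Finset.range (d + T), φ i :=
          Finset.sum_le_sum_of_subset_of_nonneg
            (Finset.range_mono (by omega)) fun i _ _ => hφ i
      _ = d * C + ∑ j ∈ Finset.range T, ψ j := by
          rw [Finset.sum_range_add]
          congr 1
          · rw [Finset.sum_congr rfl (g := fun _ => C)
              (fun i hi => by simp [φ, Finset.mem_range.1 hi])]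
            simp
          · simp [φ]
      _ ≤ d * C + 4 * b * √(d * T) := by
          gcongr
          rw [← Finset.mul_sum, Real.sqrt_mul (by positivity)]
          calc 2 * b * √d * ∑ j ∈ Finset.range T, (√((j : ℝ) + 1))⁻¹
              ≤ 2 * b * √d * (2 * √T) := by gcongr; exact sum_inv_sqrt_le T
            _ = 4 * b * (√d * √T) := by ring

end Eluder

/-! ### Conditionally sub-Gaussian variables -/

section SubGaussian

lemma exists_finite_range_tendsto {Ω : Type*} [MeasurableSpace Ω] {Λ : Ω → ℝ} (hΛ : Measurable Λ) :
    ∃ S : ℕ → Ω → ℝ, (∀ n, Measurable (S n)) ∧ (∀ n, (Set.range (S n)).Finite) ∧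
      ∀ ω, Tendsto (fun n => S n ω) atTop (𝓝 (Λ ω)) :=
  ⟨fun n => hΛ.stronglyMeasurable.approx n, fun n => (hΛ.stronglyMeasurable.approx n).measurable,
    fun n => (hΛ.stronglyMeasurable.approx n).finite_range,
    hΛ.stronglyMeasurable.tendsto_approx⟩

variable {Ω : Type*} {m m0 : MeasurableSpace Ω} {μ : Measure Ω} [IsProbabilityMeasure μ]
  {ξ : Ω → ℝ} {σ : ℝ}

/-- The measure with density `exp (v ξ - v²σ²/2)` is dominated by `μ` on `m`. Working in `ℝ≥0∞`
spares any integrability of `Y`. -/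
lemma lintegral_mul_exp_const_le (hm : m ≤ m0) (hξ : Measurable ξ)
    {v : ℝ} (hint : Integrable (fun ω => Real.exp (v * ξ ω)) μ)
    (hsub : μ[fun ω => Real.exp (v * ξ ω) | m] ≤ᵐ[μ] fun _ => Real.exp (v ^ 2 * σ ^ 2 / 2))
    {Y : Ω → ℝ≥0∞} (hY : Measurable[m] Y) :
    ∫⁻ ω, Y ω * ENNReal.ofReal (Real.exp (v * ξ ω - v ^ 2 * σ ^ 2 / 2)) ∂μ ≤ ∫⁻ ω, Y ω ∂μ := by
  set φ : Ω → ℝ≥0∞ := fun ω => ENNReal.ofReal (Real.exp (v * ξ ω - v ^ 2 * σ ^ 2 / 2)) with hφ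
  have hφm : Measurable φ := by fun_prop
  have hle : (μ.withDensity φ).trim hm ≤ μ.trim hm := by
    refine Measure.le_iff.2 fun s hs => ?_
    rw [trim_measurableSet_eq hm hs, trim_measurableSet_eq hm hs, withDensity_apply _ (hm s hs)]
    have hexp : ∀ ω, Real.exp (v * ξ ω - v ^ 2 * σ ^ 2 / 2) =
        Real.exp (v * ξ ω) * Real.exp (-(v ^ 2 * σ ^ 2 / 2)) := fun ω => by
      rw [← Real.exp_add, sub_eq_add_neg]
    have h1 : ∫ ω in s, Real.exp (v * ξ ω) ∂μ ≤ μ.real s * Real.exp (v ^ 2 * σ ^ 2 / 2) := by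
      rw [← setIntegral_condExp hm hint hs]
      calc ∫ ω in s, (μ[fun ω => Real.exp (v * ξ ω) | m]) ω ∂μ
          ≤ ∫ ω in s, Real.exp (v ^ 2 * σ ^ 2 / 2) ∂μ :=
            integral_mono_ae integrable_condExp.integrableOn (integrable_const _)
              (ae_restrict_of_ae hsub)
        _ = μ.real s * Real.exp (v ^ 2 * σ ^ 2 / 2) := by simp
    simp only [hφ, hexp]
    rw [← ofReal_integral_eq_lintegral_ofReal (hint.mul_const _).integrableOn
      (ae_of_all _ fun ω => by positivity), integral_mul_const]
    refine ENNReal.ofReal_le_of_le_toReal ?_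
    calc (∫ ω in s, Real.exp (v * ξ ω) ∂μ) * Real.exp (-(v ^ 2 * σ ^ 2 / 2))
        ≤ μ.real s * Real.exp (v ^ 2 * σ ^ 2 / 2) * Real.exp (-(v ^ 2 * σ ^ 2 / 2)) := by gcongr
      _ = μ.real s := by rw [mul_assoc, ← Real.exp_add]; simp
  calc ∫⁻ ω, Y ω * φ ω ∂μ = ∫⁻ ω, Y ω ∂(μ.withDensity φ) := by
        rw [lintegral_withDensity_eq_lintegral_mul _ hφm (hY.mono hm le_rfl)]
        simp [mul_comm]
    _ = ∫⁻ ω, Y ω ∂((μ.withDensity φ).trim hm) := (lintegral_trim hm hY).symm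
    _ ≤ ∫⁻ ω, Y ω ∂(μ.trim hm) := lintegral_mono' hle le_rfl
    _ = ∫⁻ ω, Y ω ∂μ := lintegral_trim hm hY

/-- The conditional sub-Gaussian bound holds for random, predictable exponents. -/
lemma lintegral_mul_exp_le (hm : m ≤ m0) (hξ : Measurable ξ)
    (hsub : ∀ l : ℝ, Integrable (fun ω => Real.exp (l * ξ ω)) μ ∧
      μ[fun ω => Real.exp (l * ξ ω) | m] ≤ᵐ[μ] fun _ => Real.exp (l ^ 2 * σ ^ 2 / 2))
    {Λ : Ω → ℝ} (hΛ : Measurable[m] Λ) {Y : Ω → ℝ≥0∞} (hY : Measurable[m] Y) :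
    ∫⁻ ω, Y ω * ENNReal.ofReal (Real.exp (Λ ω * ξ ω - Λ ω ^ 2 * σ ^ 2 / 2)) ∂μ ≤
      ∫⁻ ω, Y ω ∂μ := by
  have hsimple : ∀ S : Ω → ℝ, Measurable[m] S → (Set.range S).Finite →
      ∫⁻ ω, Y ω * ENNReal.ofReal (Real.exp (S ω * ξ ω - S ω ^ 2 * σ ^ 2 / 2)) ∂μ ≤
        ∫⁻ ω, Y ω ∂μ := by
    intro S hS hfin
    have hset : ∀ v, MeasurableSet[m] (S ⁻¹' {v}) := fun v => hS (measurableSet_singleton v)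
    have hdecomp : ∀ Z : ℝ → Ω → ℝ≥0∞, ∀ ω, Z (S ω) ω =
        ∑ v ∈ hfin.toFinset, (S ⁻¹' {v}).indicator (Z v) ω := by
      intro Z ω
      rw [Finset.sum_eq_single (S ω)]
      · simp
      · intro v _ hv
        exact Set.indicator_of_notMem (fun h => hv h.symm) _
      · intro h
        exact absurd (hfin.mem_toFinset.2 ⟨ω, rfl⟩) h
    have hYm : ∀ v, Measurable[m] ((S ⁻¹' {v}).indicator Y) := fun v => hY.indicator (hset v)
    calc ∫⁻ ω, Y ω * ENNReal.ofReal (Real.exp (S ω * ξ ω - S ω ^ 2 * σ ^ 2 / 2)) ∂μ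
        = ∫⁻ ω, ∑ v ∈ hfin.toFinset, (S ⁻¹' {v}).indicator Y ω *
            ENNReal.ofReal (Real.exp (v * ξ ω - v ^ 2 * σ ^ 2 / 2)) ∂μ := by
          refine lintegral_congr fun ω => ?_
          rw [hdecomp (fun v ω => Y ω *
            ENNReal.ofReal (Real.exp (v * ξ ω - v ^ 2 * σ ^ 2 / 2))) ω]
          refine Finset.sum_congr rfl fun v _ => ?_
          by_cases h : ω ∈ S ⁻¹' {v}
          · simp only [Set.indicator_of_mem h]
          · simp only [Set.indicator_of_notMem h, zero_mul]
      _ = ∑ v ∈ hfin.toFinset, ∫⁻ ω, (S ⁻¹' {v}).indicator Y ω *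
            ENNReal.ofReal (Real.exp (v * ξ ω - v ^ 2 * σ ^ 2 / 2)) ∂μ := by
          refine lintegral_finsetSum _ fun v _ => ((hYm v).mono hm le_rfl).mul ?_
          fun_prop
      _ ≤ ∑ v ∈ hfin.toFinset, ∫⁻ ω, (S ⁻¹' {v}).indicator Y ω ∂μ :=
          Finset.sum_le_sum fun v _ =>
            lintegral_mul_exp_const_le hm hξ (hsub v).1 (hsub v).2 (hYm v)
      _ = ∫⁻ ω, Y ω ∂μ := by
          rw [← lintegral_finsetSum _ fun v _ => (hYm v).mono hm le_rfl]
          exact lintegral_congr fun ω => (hdecomp (fun _ => Y) ω).symm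
  -- The approximations are measurable for `m`, not merely for `m0`, so the finite-range case
  -- applies; Fatou's lemma then passes to the limit without domination.
  obtain ⟨S, hS, hfin, hSΛ⟩ := @exists_finite_range_tendsto Ω m Λ hΛ
  have hlim : ∀ ω, Tendsto (fun n => Y ω *
      ENNReal.ofReal (Real.exp (S n ω * ξ ω - S n ω ^ 2 * σ ^ 2 / 2))) atTop
      (𝓝 (Y ω * ENNReal.ofReal (Real.exp (Λ ω * ξ ω - Λ ω ^ 2 * σ ^ 2 / 2)))) := by
    intro ω
    refine ENNReal.Tendsto.const_mul (ENNReal.tendsto_ofReal ?_)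
      (Or.inl (by simp [Real.exp_pos]))
    have hcont : Continuous fun v : ℝ => Real.exp (v * ξ ω - v ^ 2 * σ ^ 2 / 2) := by fun_prop
    exact (hcont.tendsto _).comp (hSΛ ω)
  have hSm : ∀ n, Measurable (S n) := fun n => (hS n).mono hm le_rfl
  calc ∫⁻ ω, Y ω * ENNReal.ofReal (Real.exp (Λ ω * ξ ω - Λ ω ^ 2 * σ ^ 2 / 2)) ∂μ
      = ∫⁻ ω, liminf (fun n => Y ω *
          ENNReal.ofReal (Real.exp (S n ω * ξ ω - S n ω ^ 2 * σ ^ 2 / 2))) atTop ∂μ :=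
        lintegral_congr fun ω => (hlim ω).liminf_eq.symm
    _ ≤ liminf (fun n => ∫⁻ ω, Y ω *
          ENNReal.ofReal (Real.exp (S n ω * ξ ω - S n ω ^ 2 * σ ^ 2 / 2)) ∂μ) atTop := by
        refine lintegral_liminf_le fun n => (hY.mono hm le_rfl).mul ?_
        have := hSm n
        fun_prop
    _ ≤ ∫⁻ ω, Y ω ∂μ :=
        liminf_le_of_le (by isBoundedDefault) fun b hb => by
          obtain ⟨n, hn⟩ := hb.exists
          exact hn.trans (hsimple (S n) (hS n) (hfin n))

/-- Combines `|x| ≤ eˣ + e⁻ˣ` with the exponents `±1`. -/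
lemma lintegral_abs_le (hm : m ≤ m0) (hξ : Measurable ξ)
    (hsub : ∀ l : ℝ, Integrable (fun ω => Real.exp (l * ξ ω)) μ ∧
      μ[fun ω => Real.exp (l * ξ ω) | m] ≤ᵐ[μ] fun _ => Real.exp (l ^ 2 * σ ^ 2 / 2)) :
    ∫⁻ ω, ENNReal.ofReal |ξ ω| ∂μ ≤ ENNReal.ofReal (2 * Real.exp (σ ^ 2 / 2)) := by
  have h : ∀ v : ℝ, v ^ 2 = 1 →
      ∫⁻ ω, ENNReal.ofReal (Real.exp (v * ξ ω - σ ^ 2 / 2)) ∂μ ≤ 1 := by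
    intro v hv
    simpa [hv] using lintegral_mul_exp_const_le (σ := σ) (Y := fun _ => 1) hm hξ (hsub v).1
      (hsub v).2 measurable_const
  have hpt : ∀ ω, ENNReal.ofReal |ξ ω| ≤ ENNReal.ofReal (Real.exp (σ ^ 2 / 2)) *
      (ENNReal.ofReal (Real.exp (1 * ξ ω - σ ^ 2 / 2)) +
        ENNReal.ofReal (Real.exp (-1 * ξ ω - σ ^ 2 / 2))) := by
    intro ω
    rw [← ENNReal.ofReal_add (by positivity) (by positivity), ← ENNReal.ofReal_mul (by positivity)]
    refine ENNReal.ofReal_le_ofReal ?_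
    rw [mul_add, ← Real.exp_add, ← Real.exp_add]
    have h1 := Real.add_one_le_exp (ξ ω)
    have h2 := Real.add_one_le_exp (-ξ ω)
    have h3 := Real.exp_pos (ξ ω)
    have h4 := Real.exp_pos (-ξ ω)
    rw [show σ ^ 2 / 2 + (1 * ξ ω - σ ^ 2 / 2) = ξ ω by ring,
      show σ ^ 2 / 2 + (-1 * ξ ω - σ ^ 2 / 2) = -ξ ω by ring]
    exact abs_le'.2 ⟨by linarith, by linarith⟩
  calc ∫⁻ ω, ENNReal.ofReal |ξ ω| ∂μ
      ≤ ∫⁻ ω, ENNReal.ofReal (Real.exp (σ ^ 2 / 2)) *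
        (ENNReal.ofReal (Real.exp (1 * ξ ω - σ ^ 2 / 2)) +
          ENNReal.ofReal (Real.exp (-1 * ξ ω - σ ^ 2 / 2))) ∂μ := lintegral_mono hpt
    _ = ENNReal.ofReal (Real.exp (σ ^ 2 / 2)) *
        (∫⁻ ω, ENNReal.ofReal (Real.exp (1 * ξ ω - σ ^ 2 / 2)) ∂μ +
          ∫⁻ ω, ENNReal.ofReal (Real.exp (-1 * ξ ω - σ ^ 2 / 2)) ∂μ) := by
        rw [lintegral_const_mul _ (by fun_prop), lintegral_add_left (by fun_prop)]
    _ ≤ ENNReal.ofReal (Real.exp (σ ^ 2 / 2)) * (1 + 1) := by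
        gcongr
        · exact h 1 (by norm_num)
        · exact h (-1) (by norm_num)
    _ = ENNReal.ofReal (2 * Real.exp (σ ^ 2 / 2)) := by
        rw [mul_comm 2, ENNReal.ofReal_mul (by positivity)]
        norm_num

end SubGaussian

/-! ### Measurability and concentration along the history -/

namespace BanditProcess

variable {Ω Θ 𝒜 : Type*} [MeasurableSpace 𝒜]
  {X : BanditProcess Ω Θ 𝒜} {mS : MeasurableSpace (Set 𝒜)} {f : Θ → 𝒜 → ℝ}

lemma measurable_action_history {s t : ℕ} (h : s < t) : Measurable[X.history mS t] (X.action s) :=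
  measurable_iff_comap_le.2 <| le_sup_of_le_right <|
    le_iSup₂_of_le (f := fun s (_ : s ∈ Set.Iio t) =>
      MeasurableSpace.comap (X.action s) inferInstance ⊔
        MeasurableSpace.comap (X.reward s) inferInstance) s h le_sup_left

lemma measurable_reward_history {s t : ℕ} (h : s < t) : Measurable[X.history mS t] (X.reward s) :=
  measurable_iff_comap_le.2 <| le_sup_of_le_right <|
    le_iSup₂_of_le (f := fun s (_ : s ∈ Set.Iio t) =>
      MeasurableSpace.comap (X.action s) inferInstance ⊔
        MeasurableSpace.comap (X.reward s) inferInstance) s h le_sup_right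

variable [MeasurableSpace Θ]

lemma history_le_historyParamAction (t : ℕ) : X.history mS t ≤ X.historyParamAction mS t :=
  le_sup_of_le_left le_sup_left

lemma measurable_param_historyParamAction (t : ℕ) :
    Measurable[X.historyParamAction mS t] X.param :=
  measurable_iff_comap_le.2 <| le_sup_of_le_left le_sup_right

lemma measurable_action_historyParamAction (t : ℕ) :
    Measurable[X.historyParamAction mS t] (X.action t) :=
  measurable_iff_comap_le.2 le_sup_right

lemma measurable_mean {m : MeasurableSpace Ω} (hf : Measurable (Function.uncurry f))
    {p : Ω → Θ} {a : Ω → 𝒜} (hp : Measurable[m] p) (ha : Measurable[m] a) :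
    Measurable[m] fun ω => f (p ω) (a ω) :=
  hf.comp (hp.prodMk ha)

variable [MeasurableSpace Ω] {μ : Measure Ω} {σ : ℝ}

namespace IsBandit

lemma history_le (hX : X.IsBandit mS f μ) (t : ℕ) : X.history mS t ≤ ‹MeasurableSpace Ω› :=
  sup_le (iSup₂_le fun s _ => (hX.measurable_actionSet s).comap_le)
    (iSup₂_le fun s _ => sup_le (hX.measurable_action s).comap_le (hX.measurable_reward s).comap_le)

lemma historyParamAction_le (hX : X.IsBandit mS f μ) (t : ℕ) :
    X.historyParamAction mS t ≤ ‹MeasurableSpace Ω› :=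
  sup_le (sup_le (hX.history_le t) hX.measurable_param.comap_le) (hX.measurable_action t).comap_le

lemma measurable_apply (hX : X.IsBandit mS f μ) (ρ : Θ) : Measurable (f ρ) :=
  hX.measurable_f.comp measurable_prodMk_left

lemma measurable_noise (hX : X.IsBandit mS f μ) (t : ℕ) : Measurable (X.noise f t) :=
  (hX.measurable_reward t).sub (measurable_mean hX.measurable_f hX.measurable_param (hX.measurable_action t))

lemma measurable_noise_historyParamAction (hX : X.IsBandit mS f μ) {s t : ℕ} (h : s < t) :
    Measurable[X.historyParamAction mS t] (X.noise f s) :=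
  ((measurable_reward_history h).mono (history_le_historyParamAction t) le_rfl).sub
    (measurable_mean hX.measurable_f (measurable_param_historyParamAction t)
      ((measurable_action_history h).mono (history_le_historyParamAction t) le_rfl))

end IsBandit

/-- The excess of half the squared distance of `g` to the true reward function on the past
over the difference of their squared losses. -/
noncomputable def lossGap (X : BanditProcess Ω Θ 𝒜) (f : Θ → 𝒜 → ℝ) (g : 𝒜 → ℝ) (t : ℕ) (ω : Ω) : ℝ :=
  ∑ k ∈ Finset.range t, (2 * (g (X.action k ω) - f (X.param ω) (X.action k ω)) * X.noise f k ω -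
    (g (X.action k ω) - f (X.param ω) (X.action k ω)) ^ 2 / 2)

lemma IsBandit.measurable_lossGap (hX : X.IsBandit mS f μ) {g : 𝒜 → ℝ} (hg : Measurable g) (t : ℕ) :
    Measurable[X.historyParamAction mS t] (X.lossGap f g t) := by
  unfold lossGap
  refine Finset.measurable_sum _ fun k hk => ?_
  have hk := Finset.mem_range.1 hk
  have h1 := hX.measurable_noise_historyParamAction hk
  have ha : Measurable[X.historyParamAction mS t] (X.action k) :=
    (measurable_action_history hk).mono (history_le_historyParamAction t) le_rfl
  have h2 := (hg.comp ha).sub (measurable_mean hX.measurable_f (measurable_param_historyParamAction t) ha)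
  exact ((h2.const_mul 2).mul h1).sub ((h2.pow_const 2).div_const 2)

variable [IsProbabilityMeasure μ]

/-- With `D = g(A) - f_θ(A)` and `Λ = D / (2σ²)`, a new summand divided by `4σ²` is exactly `Λξ -
Λ²σ²/2`. As `Λ` is known given `(H, θ, A)`, each period multiplies by a factor of conditional mean
at most 1. -/
lemma lintegral_exp_lossGap_le (hX : X.IsBandit mS f μ) (hN : X.HasSubGaussianNoise mS f μ σ)
    (hσ : 0 < σ) {g : 𝒜 → ℝ} (hg : Measurable g) (t : ℕ) :
    ∫⁻ ω, ENNReal.ofReal (Real.exp (X.lossGap f g t ω / (4 * σ ^ 2))) ∂μ ≤ 1 := by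
  induction t with
  | zero => simp [lossGap]
  | succ t ih =>
    refine le_trans ?_ ih
    have hD := ((hg.comp (measurable_action_historyParamAction (X := X) (mS := mS) t)).sub
      (measurable_mean hX.measurable_f (measurable_param_historyParamAction t)
        (measurable_action_historyParamAction t))).div_const (2 * σ ^ 2)
    have hY := (Real.measurable_exp.comp
      ((hX.measurable_lossGap hg t).div_const (4 * σ ^ 2))).ennreal_ofReal
    refine le_trans (le_of_eq ?_) (lintegral_mul_exp_le (hX.historyParamAction_le t)
      (hX.measurable_noise t) (hN t) hD hY)
    refine lintegral_congr fun ω => ?_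
    simp only [Function.comp, Pi.sub_apply]
    rw [← ENNReal.ofReal_mul (by positivity), ← Real.exp_add]
    congr 2
    rw [lossGap, Finset.sum_range_succ, ← lossGap]
    field_simp
    ring

lemma measure_le_lossGap (hX : X.IsBandit mS f μ) (hN : X.HasSubGaussianNoise mS f μ σ)
    (hσ : 0 < σ) {g : 𝒜 → ℝ} (hg : Measurable g) (t : ℕ) (L : ℝ) :
    μ.real {ω | 4 * σ ^ 2 * L ≤ X.lossGap f g t ω} ≤ Real.exp (-L) := by
  have hm := (hX.measurable_lossGap hg t).mono (hX.historyParamAction_le t) le_rfl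
  have h1 := mul_meas_ge_le_lintegral (μ := μ)
    (Real.measurable_exp.comp (hm.div_const (4 * σ ^ 2))).ennreal_ofReal
    (ENNReal.ofReal (Real.exp L))
  have h2 := h1.trans (lintegral_exp_lossGap_le hX hN hσ hg t)
  have hset : {ω | 4 * σ ^ 2 * L ≤ X.lossGap f g t ω} = {ω | ENNReal.ofReal (Real.exp L) ≤
      ENNReal.ofReal ((Real.exp ∘ fun ω => X.lossGap f g t ω / (4 * σ ^ 2)) ω)} := by
    ext ω
    simp only [Set.mem_ofPred_eq, Function.comp]
    rw [ENNReal.ofReal_le_ofReal_iff (by positivity), Real.exp_le_exp, le_div_iff₀ (by positivity),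
      mul_comm L]
  rw [← hset] at h2
  have h3 := ENNReal.toReal_mono ENNReal.one_ne_top h2
  rw [ENNReal.toReal_mul, ENNReal.toReal_ofReal (by positivity), ENNReal.toReal_one] at h3
  rw [Real.exp_neg, ← one_div, le_div_iff₀ (by positivity), mul_comm]
  exact h3

/-- Markov's inequality. So crude a bound suffices, since the sum is used only after multiplication
by the scale of the net. -/
lemma measure_lt_sum_abs_noise (hX : X.IsBandit mS f μ) (hN : X.HasSubGaussianNoise mS f μ σ)
    (t : ℕ) {y : ℝ} (hy : 0 < y) :
    μ.real {ω | y < ∑ k ∈ Finset.range t, |X.noise f k ω|} ≤ t * (2 * Real.exp (σ ^ 2 / 2)) / y := by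
  have hm : Measurable fun ω => ∑ k ∈ Finset.range t, |X.noise f k ω| :=
    Finset.measurable_sum _ fun k _ => (hX.measurable_noise k).abs
  have h1 := mul_meas_ge_le_lintegral (μ := μ) hm.ennreal_ofReal (ENNReal.ofReal y)
  have h2 : ∫⁻ ω, ENNReal.ofReal (∑ k ∈ Finset.range t, |X.noise f k ω|) ∂μ ≤
      ENNReal.ofReal (t * (2 * Real.exp (σ ^ 2 / 2))) := by
    calc ∫⁻ ω, ENNReal.ofReal (∑ k ∈ Finset.range t, |X.noise f k ω|) ∂μ
        = ∑ k ∈ Finset.range t, ∫⁻ ω, ENNReal.ofReal |X.noise f k ω| ∂μ := by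
          rw [← lintegral_finsetSum _ fun k _ => (hX.measurable_noise k).abs.ennreal_ofReal]
          exact lintegral_congr fun ω => ENNReal.ofReal_sum_of_nonneg fun _ _ => abs_nonneg _
      _ ≤ ∑ k ∈ Finset.range t, ENNReal.ofReal (2 * Real.exp (σ ^ 2 / 2)) :=
          Finset.sum_le_sum fun k _ => lintegral_abs_le (hX.historyParamAction_le k)
            (hX.measurable_noise k) (hN k)
      _ = ENNReal.ofReal (t * (2 * Real.exp (σ ^ 2 / 2))) := by
          rw [ENNReal.ofReal_mul (by positivity)]
          simp
  have h3 := ENNReal.toReal_mono ENNReal.ofReal_ne_top (h1.trans h2)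
  rw [ENNReal.toReal_mul, ENNReal.toReal_ofReal hy.le, ENNReal.toReal_ofReal (by positivity)] at h3
  rw [le_div_iff₀ hy, mul_comm]
  refine le_trans ?_ h3
  gcongr
  refine measureReal_mono fun ω hω => ?_
  exact ENNReal.ofReal_le_ofReal (le_of_lt hω)

end BanditProcess

/-- The Euclidean triangle inequality in squared form. -/
lemma sum_sub_sq_le {ι : Type*} (s : Finset ι) (u v : ι → ℝ) {p q : ℝ} (hp : 0 ≤ p) (hq : 0 ≤ q)
    (hu : ∑ k ∈ s, u k ^ 2 ≤ p ^ 2) (hv : ∑ k ∈ s, v k ^ 2 ≤ q ^ 2) :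
    ∑ k ∈ s, (u k - v k) ^ 2 ≤ (p + q) ^ 2 := by
  have h1 : (∑ k ∈ s, u k * v k) ^ 2 ≤ (p * q) ^ 2 := by
    rw [mul_pow]
    exact (Finset.sum_mul_sq_le_sq_mul_sq s u v).trans
      (mul_le_mul hu hv (Finset.sum_nonneg fun _ _ => sq_nonneg _) (sq_nonneg p))
  have h2 := (abs_le.1 (abs_le_of_sq_le_sq h1 (by positivity))).1
  have h3 : ∑ k ∈ s, (u k - v k) ^ 2 =
      ∑ k ∈ s, u k ^ 2 - 2 * ∑ k ∈ s, u k * v k + ∑ k ∈ s, v k ^ 2 := by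
    rw [Finset.mul_sum, ← Finset.sum_sub_distrib, ← Finset.sum_add_distrib]
    exact Finset.sum_congr rfl fun _ _ => by ring
  nlinarith

/-! ### Exchanging the selected and the optimal action -/

section Exchange

variable {Ω 𝒜 κ : Type*} {m m0 : MeasurableSpace Ω} [MeasurableSpace 𝒜] {μ : Measure Ω}
  [Fintype κ]

lemma measurable_comp_fiberwise {K : Ω → κ} (hK : ∀ S, MeasurableSet (K ⁻¹' {S}))
    {Φ : κ → 𝒜 → ℝ} (hΦ : ∀ S, Measurable (Φ S)) {A : Ω → 𝒜} (hA : Measurable A) :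
    Measurable fun ω => Φ (K ω) (A ω) := by
  let : MeasurableSpace κ := ⊤
  have hKm : Measurable K := measurable_to_countable' hK
  have hΦm : Measurable (Function.uncurry Φ) := measurable_from_prod_countable_right hΦ
  exact hΦm.comp (hKm.prodMk hA)

lemma integral_comp_fiberwise [IsFiniteMeasure μ] {K : Ω → κ}
    (hK : ∀ S, MeasurableSet (K ⁻¹' {S})) {Φ : κ → 𝒜 → ℝ} (hΦ : ∀ S, Measurable (Φ S)) {C : ℝ}
    (hC : ∀ S a, |Φ S a| ≤ C) {A : Ω → 𝒜} (hA : Measurable A) :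
    ∫ ω, Φ (K ω) (A ω) ∂μ = ∑ S, ∫ a, Φ S a ∂((μ.restrict (K ⁻¹' {S})).map A) := by
  have hdecomp : ∀ ω, Φ (K ω) (A ω) = ∑ S, (K ⁻¹' {S}).indicator (fun ω => Φ S (A ω)) ω := by
    intro ω
    rw [Finset.sum_eq_single (K ω)]
    · simp
    · intro v _ hv
      exact Set.indicator_of_notMem (fun h => hv h.symm) _
    · simp
  simp_rw [hdecomp]
  rw [integral_finsetSum]
  · refine Finset.sum_congr rfl fun S _ => ?_
    rw [integral_indicator (hK S), integral_map hA.aemeasurable (hΦ S).aestronglyMeasurable]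
  · intro S _
    refine Integrable.indicator ?_ (hK S)
    exact Integrable.of_bound ((hΦ S).comp hA).aestronglyMeasurable C
      (ae_of_all _ fun ω => hC S (A ω))

/-- Two actions with the same conditional law give the same expectation to a function of the
action which depends on the conditioning information. -/
lemma integral_comp_eq_of_condLaw_eq [IsProbabilityMeasure μ] (hm : m ≤ m0) {K : Ω → κ}
    (hK : ∀ S, MeasurableSet[m] (K ⁻¹' {S})) {Φ : κ → 𝒜 → ℝ} (hΦ : ∀ S, Measurable (Φ S)) {C : ℝ}
    (hC : ∀ S a, |Φ S a| ≤ C) {A A' : Ω → 𝒜} (hA : Measurable A) (hA' : Measurable A')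
    (h : ∀ B : Set 𝒜, MeasurableSet B → μ⟦A ⁻¹' B | m⟧ =ᵐ[μ] μ⟦A' ⁻¹' B | m⟧) :
    ∫ ω, Φ (K ω) (A ω) ∂μ = ∫ ω, Φ (K ω) (A' ω) ∂μ := by
  rw [integral_comp_fiberwise (fun S => hm _ (hK S)) hΦ hC hA,
    integral_comp_fiberwise (fun S => hm _ (hK S)) hΦ hC hA']
  refine Finset.sum_congr rfl fun S _ => ?_
  congr 1
  ext B hB
  -- Since `K` has finitely many values, it is enough to compare the laws of the two actions on each
  -- event `K = S`, by integrating the conditional probabilities over it.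
  have key : ∀ A : Ω → 𝒜, Measurable A →
      ∫ ω in K ⁻¹' {S}, (μ⟦A ⁻¹' B | m⟧) ω ∂μ = ((μ.restrict (K ⁻¹' {S})).map A).real B := by
    intro A hA
    rw [setIntegral_condExp hm ((integrable_const _).indicator (hA hB)) (hK S),
      integral_indicator (hA hB), map_measureReal_apply hA hB]
    simp
  rw [← measureReal_eq_measureReal_iff, ← key A hA, ← key A' hA']
  exact setIntegral_congr_ae (hm _ (hK S)) ((h B hB).mono fun _ h _ => h)

end Exchange

/-! ### Envelopes of finite families -/

section Envelope

variable {𝒜 ι : Type*} {g : ι → 𝒜 → ℝ} {C : ℝ}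

/-- The pointwise maximum of a set of functions. -/
noncomputable def upper (g : ι → 𝒜 → ℝ) (S : Set ι) (a : 𝒜) : ℝ := ⨆ i : S, g i a

/-- The pointwise minimum of a set of functions. -/
noncomputable def lower (g : ι → 𝒜 → ℝ) (S : Set ι) (a : 𝒜) : ℝ := ⨅ i : S, g i a

/-- This includes the empty set, where the real supremum is 0 by default. -/
lemma upper_mem_Icc (hC : 0 ≤ C) (hg : ∀ i a, g i a ∈ Set.Icc 0 C) (S : Set ι) (a : 𝒜) :
    upper g S a ∈ Set.Icc 0 C :=
  ⟨Real.iSup_nonneg fun i => (hg i a).1, Real.iSup_le (fun i => (hg i a).2) hC⟩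

variable [Finite ι]

lemma le_upper {S : Set ι} {i : ι} (hi : i ∈ S) (a : 𝒜) : g i a ≤ upper g S a :=
  le_ciSup (f := fun i : S => g i a) (Set.finite_range _).bddAbove ⟨i, hi⟩

lemma lower_le {S : Set ι} {i : ι} (hi : i ∈ S) (a : 𝒜) : lower g S a ≤ g i a :=
  ciInf_le (f := fun i : S => g i a) (Set.finite_range _).bddBelow ⟨i, hi⟩

lemma lower_mem_Icc (hC : 0 ≤ C) (hg : ∀ i a, g i a ∈ Set.Icc 0 C) (S : Set ι) (a : 𝒜) :
    lower g S a ∈ Set.Icc 0 C := by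
  refine ⟨Real.iInf_nonneg fun i => (hg i a).1, ?_⟩
  rcases S.eq_empty_or_nonempty with rfl | ⟨i, hi⟩
  · simpa [lower] using hC
  · exact (lower_le hi a).trans (hg i a).2

lemma exists_lt_of_lt_upper_sub_lower {S : Set ι} {a : 𝒜} {ε : ℝ} (hε : 0 < ε)
    (h : ε < upper g S a - lower g S a) : ∃ i ∈ S, ∃ j ∈ S, ε < g i a - g j a := by
  rcases S.eq_empty_or_nonempty with rfl | hS
  · simp only [upper, lower, Real.iSup_of_isEmpty, Real.iInf_of_isEmpty] at h
    linarith
  · have := hS.to_subtype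
    obtain ⟨i, hi⟩ := exists_eq_ciSup_of_finite (f := fun i : S => g i a)
    obtain ⟨j, hj⟩ := exists_eq_ciInf_of_finite (f := fun i : S => g i a)
    exact ⟨i, i.2, j, j.2, by rw [hi, hj]; exact h⟩

lemma measurable_upper [MeasurableSpace 𝒜] (hg : ∀ i, Measurable (g i)) (S : Set ι) :
    Measurable (upper g S) :=
  Measurable.iSup fun i : S => hg i

lemma measurable_lower [MeasurableSpace 𝒜] (hg : ∀ i, Measurable (g i)) (S : Set ι) :
    Measurable (lower g S) :=
  Measurable.iInf fun i : S => hg i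

end Envelope

/-! ### Confidence sets and the regret bound for a net -/

namespace BanditProcess

variable {Ω Θ 𝒜 ι : Type*}

/-- The cumulative squared prediction error of `h` on the past. -/
def sqLoss (X : BanditProcess Ω Θ 𝒜) (h : 𝒜 → ℝ) (t : ℕ) (ω : Ω) : ℝ :=
  ∑ k ∈ Finset.range t, (h (X.action k ω) - X.reward k ω) ^ 2

/-- The confidence set: the indices of the functions that are within `b`, in empirical 2-norm, of
the least squares estimates. -/
def confSet (X : BanditProcess Ω Θ 𝒜) (g : ι → 𝒜 → ℝ) (b : ℝ) (t : ℕ) (ω : Ω) : Set ι :=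
  {i | ∀ j, (∀ j', X.sqLoss (g j) t ω ≤ X.sqLoss (g j') t ω) →
    ∑ k ∈ Finset.range t, (g i (X.action k ω) - g j (X.action k ω)) ^ 2 ≤ b ^ 2}

lemma sum_sq_le_of_mem_confSet [Finite ι] {X : BanditProcess Ω Θ 𝒜} {g : ι → 𝒜 → ℝ} {b : ℝ}
    (hb : 0 ≤ b) {t : ℕ} {ω : Ω} {i j : ι} (hi : i ∈ X.confSet g b t ω)
    (hj : j ∈ X.confSet g b t ω) :
    ∑ k ∈ Finset.range t, (g i (X.action k ω) - g j (X.action k ω)) ^ 2 ≤ (2 * b) ^ 2 := by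
  have : Nonempty ι := ⟨i⟩
  obtain ⟨l, hl⟩ := Finite.exists_min fun l => X.sqLoss (g l) t ω
  rw [two_mul]
  convert sum_sub_sq_le (Finset.range t) _ _ hb hb (hi l hl) (hj l hl) using 3
  ring

variable {X : BanditProcess Ω Θ 𝒜} {f : Θ → 𝒜 → ℝ}

/-- The event on which the confidence set is known to contain good approximations of the true
reward function. -/
def goodEvent (X : BanditProcess Ω Θ 𝒜) (f : Θ → 𝒜 → ℝ) (g : ι → 𝒜 → ℝ) (σ α L x : ℝ) (t : ℕ) :
    Set Ω :=
  {ω | (∀ i, X.lossGap f (g i) t ω < 4 * σ ^ 2 * L) ∧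
    2 * α * ∑ k ∈ Finset.range t, |X.noise f k ω| ≤ x}

/-- Let `D i`, `D j` be the errors of the approximation and of a least squares fit. Minimality gives
`∑ Dj² - 2∑ Dj ξ ≤ ∑ Di² - 2∑ Di ξ`. The event bounds `2∑ Dj ξ` by `4σ²L + ∑ Dj²/2` and the last
term by `x`, which bounds `∑ Dj²`. The triangle inequality through `f_θ` adds `√T α`. -/
lemma mem_confSet_of_mem_goodEvent {g : ι → 𝒜 → ℝ} {σ α L x : ℝ} {t T : ℕ} (htT : t ≤ T)
    (hα : 0 ≤ α) {ω : Ω} (hω : ω ∈ X.goodEvent f g σ α L x t) {i : ι}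
    (hi : ∀ a, |g i a - f (X.param ω) a| ≤ α) :
    i ∈ X.confSet g (√(8 * σ ^ 2 * L + 2 * (T * α ^ 2) + 2 * x) + √T * α) t ω := by
  intro j hj
  obtain ⟨h1, h2⟩ := hω
  let D : ι → ℕ → ℝ := fun l k => g l (X.action k ω) - f (X.param ω) (X.action k ω)
  have hloss : ∀ l, X.sqLoss (g l) t ω = ∑ k ∈ Finset.range t, D l k ^ 2 -
      2 * ∑ k ∈ Finset.range t, D l k * X.noise f k ω +
        ∑ k ∈ Finset.range t, X.noise f k ω ^ 2 := by
    intro l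
    rw [Finset.mul_sum, ← Finset.sum_sub_distrib, ← Finset.sum_add_distrib]
    refine Finset.sum_congr rfl fun k _ => ?_
    simp only [D, noise]
    ring
  have hgap : X.lossGap f (g j) t ω = 2 * ∑ k ∈ Finset.range t, D j k * X.noise f k ω -
      (∑ k ∈ Finset.range t, D j k ^ 2) / 2 := by
    rw [Finset.mul_sum, Finset.sum_div, ← Finset.sum_sub_distrib]
    refine Finset.sum_congr rfl fun k _ => ?_
    simp only [D]
    ring
  have hDi : ∑ k ∈ Finset.range t, D i k ^ 2 ≤ T * α ^ 2 := by
    calc ∑ k ∈ Finset.range t, D i k ^ 2 ≤ ∑ k ∈ Finset.range t, α ^ 2 :=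
          Finset.sum_le_sum fun k _ => sq_le_sq.2 (by rw [abs_of_nonneg hα]; exact hi _)
      _ = t * α ^ 2 := by simp
      _ ≤ T * α ^ 2 := by gcongr
  have hcross : -(2 * ∑ k ∈ Finset.range t, D i k * X.noise f k ω) ≤ x := by
    refine le_trans ?_ h2
    rw [mul_assoc, ← mul_neg, ← Finset.sum_neg_distrib, Finset.mul_sum (a := α)]
    refine mul_le_mul_of_nonneg_left (Finset.sum_le_sum fun k _ => ?_) zero_le_two
    refine (neg_le_abs _).trans ?_
    rw [abs_mul]
    exact mul_le_mul_of_nonneg_right (hi _) (abs_nonneg _)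
  have hDj : ∑ k ∈ Finset.range t, D j k ^ 2 ≤ 8 * σ ^ 2 * L + 2 * (T * α ^ 2) + 2 * x := by
    have h3 := hj i
    have h4 := h1 j
    rw [hloss, hloss] at h3
    rw [hgap] at h4
    linarith
  have hrad : 0 ≤ 8 * σ ^ 2 * L + 2 * (T * α ^ 2) + 2 * x :=
    (Finset.sum_nonneg fun _ _ => sq_nonneg _).trans hDj
  rw [add_comm (√_)]
  convert sum_sub_sq_le (Finset.range t) (D i) (D j) (p := √T * α)
    (q := √(8 * σ ^ 2 * L + 2 * (T * α ^ 2) + 2 * x)) (by positivity) (by positivity) ?_ ?_ using 3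
  · simp only [D]
    ring
  · rwa [mul_pow, Real.sq_sqrt (by positivity)]
  · rwa [Real.sq_sqrt hrad]

variable [MeasurableSpace 𝒜] {mS : MeasurableSpace (Set 𝒜)}

/-- As the definition ranges over all minimisers and selects none, membership is a finite Boolean
combination of inequalities between functions of the history. -/
lemma measurableSet_confSet_eq [Finite ι] {g : ι → 𝒜 → ℝ} (hg : ∀ i, Measurable (g i)) (b : ℝ)
    (t : ℕ) (S : Set ι) : MeasurableSet[X.history mS t] (X.confSet g b t ⁻¹' {S}) := by
  let : MeasurableSpace Ω := X.history mS t
  have hact : ∀ k ∈ Finset.range t, Measurable (X.action k) := fun k hk =>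
    measurable_action_history (Finset.mem_range.1 hk)
  have hloss : ∀ j, Measurable (X.sqLoss (g j) t) := fun j =>
    Finset.measurable_sum _ fun k hk => (((hg j).comp (hact k hk)).sub
      (measurable_reward_history (Finset.mem_range.1 hk))).pow_const 2
  have hmem : ∀ i, MeasurableSet {ω | i ∈ X.confSet g b t ω} := by
    intro i
    have : {ω | i ∈ X.confSet g b t ω} = ⋂ j,
        (⋂ j', {ω | X.sqLoss (g j) t ω ≤ X.sqLoss (g j') t ω})ᶜ ∪
          {ω | ∑ k ∈ Finset.range t, (g i (X.action k ω) - g j (X.action k ω)) ^ 2 ≤ b ^ 2} := by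
      ext ω
      simp only [confSet, Set.mem_ofPred_eq, Set.mem_iInter, Set.mem_union, Set.mem_compl_iff,
        imp_iff_not_or]
    rw [this]
    refine MeasurableSet.iInter fun j => (MeasurableSet.iInter fun j' =>
      measurableSet_le (hloss j) (hloss j')).compl.union (measurableSet_le ?_ measurable_const)
    exact Finset.measurable_sum _ fun k hk =>
      (((hg i).comp (hact k hk)).sub ((hg j).comp (hact k hk))).pow_const 2
  have : X.confSet g b t ⁻¹' {S} = ⋂ i, {ω | i ∈ X.confSet g b t ω ↔ i ∈ S} := by
    ext ω
    simp [Set.ext_iff]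
  rw [this]
  refine MeasurableSet.iInter fun i => ?_
  by_cases hi : i ∈ S
  · simpa [hi] using hmem i
  · have : {ω | i ∈ X.confSet g b t ω ↔ i ∈ S} = {ω | i ∈ X.confSet g b t ω}ᶜ := by
      ext ω
      simp [hi]
    exact this ▸ (hmem i).compl

variable [MeasurableSpace Ω] [MeasurableSpace Θ] [Fintype ι] {μ : Measure Ω} {σ : ℝ}

lemma measurableSet_goodEvent (hX : X.IsBandit mS f μ) {g : ι → 𝒜 → ℝ} (hg : ∀ i, Measurable (g i))
    (σ α L x : ℝ) (t : ℕ) : MeasurableSet (X.goodEvent f g σ α L x t) := by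
  have h1 : ∀ i, Measurable (X.lossGap f (g i) t) := fun i =>
    (hX.measurable_lossGap (hg i) t).mono (hX.historyParamAction_le t) le_rfl
  have h2 : Measurable fun ω => 2 * α * ∑ k ∈ Finset.range t, |X.noise f k ω| :=
    (Finset.measurable_sum _ fun k _ => (hX.measurable_noise k).abs).const_mul _
  rw [goodEvent, Set.ofPred_and, Set.ofPred_forall]
  exact (MeasurableSet.iInter fun i => measurableSet_lt (h1 i) measurable_const).inter
    (measurableSet_le h2 measurable_const)

variable [IsProbabilityMeasure μ]

lemma measure_goodEvent_compl_le (hX : X.IsBandit mS f μ) (hN : X.HasSubGaussianNoise mS f μ σ)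
    (hσ : 0 < σ) {g : ι → 𝒜 → ℝ} (hg : ∀ i, Measurable (g i)) (α L x : ℝ) (t : ℕ) :
    μ.real (X.goodEvent f g σ α L x t)ᶜ ≤ Fintype.card ι * Real.exp (-L) +
      μ.real {ω | x < 2 * α * ∑ k ∈ Finset.range t, |X.noise f k ω|} := by
  have hsub : (X.goodEvent f g σ α L x t)ᶜ ⊆ (⋃ i, {ω | 4 * σ ^ 2 * L ≤ X.lossGap f (g i) t ω}) ∪
      {ω | x < 2 * α * ∑ k ∈ Finset.range t, |X.noise f k ω|} := by
    intro ω hω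
    simp only [goodEvent, Set.mem_compl_iff, Set.mem_ofPred_eq, not_and_or, not_forall, not_lt,
      not_le] at hω
    simpa using hω
  refine (measureReal_mono hsub).trans ((measureReal_union_le _ _).trans ?_)
  gcongr
  refine (measureReal_iUnion_fintype_le _).trans ?_
  refine (Finset.sum_le_sum fun i _ => measure_le_lossGap hX hN hσ (hg i) t L).trans ?_
  simp

/-- Regret of posterior sampling in terms of a finite net of the class of reward functions. -/
lemma bayesRegret_le_of_net {F : Set (𝒜 → ℝ)} {C : ℝ} (hC : 0 ≤ C) (hσ : 0 < σ)
    (hF : ∀ h ∈ F, ∀ a, h a ∈ Set.Icc 0 C) (hfF : Set.range f = F) (hX : X.IsBandit mS f μ)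
    (hN : X.HasSubGaussianNoise mS f μ σ) (hPS : X.IsPosteriorSampling mS f μ) {T d : ℕ}
    (hT : 1 ≤ T) (hd : eluderDim F (T : ℝ)⁻¹ ≤ d) {g : ι → 𝒜 → ℝ} (hgF : ∀ i, g i ∈ F)
    {α L x q : ℝ} (hα : 0 ≤ α) (hnet : ∀ h ∈ F, ∃ i, ∀ a, |g i a - h a| ≤ α)
    (hq : ∀ t < T, μ.real {ω | x < 2 * α * ∑ k ∈ Finset.range t, |X.noise f k ω|} ≤ q) :
    X.bayesRegret f μ T ≤ T * (2 * α + 2 * C * (Fintype.card ι * Real.exp (-L) + q)) +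
      (1 + d * C +
        4 * (√(8 * σ ^ 2 * L + 2 * (T * α ^ 2) + 2 * x) + √T * α) * √(d * T)) := by
  set b := √(8 * σ ^ 2 * L + 2 * (T * α ^ 2) + 2 * x) + √T * α with hb
  have hb0 : 0 ≤ b := by positivity
  have hgC : ∀ i a, g i a ∈ Set.Icc 0 C := fun i => hF _ (hgF i)
  have hfC : ∀ ρ a, f ρ a ∈ Set.Icc 0 C := fun ρ => hF _ (hfF ▸ ⟨ρ, rfl⟩)
  have hg : ∀ i, Measurable (g i) := fun i => by
    obtain ⟨ρ, hρ⟩ : g i ∈ Set.range f := hfF ▸ hgF i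
    exact hρ ▸ hX.measurable_apply ρ
  choose Astar hAm hAopt hAlaw using hPS
  have hK : ∀ t S, MeasurableSet (X.confSet g b t ⁻¹' {S}) := fun t S =>
    hX.history_le t _ (measurableSet_confSet_eq hg b t S)
  have hupb : ∀ S a, |upper g S a| ≤ C := fun S a => by
    rw [abs_of_nonneg (upper_mem_Icc hC hgC S a).1]
    exact (upper_mem_Icc hC hgC S a).2
  have hlob : ∀ S a, |lower g S a| ≤ C := fun S a => by
    rw [abs_of_nonneg (lower_mem_Icc hC hgC S a).1]
    exact (lower_mem_Icc hC hgC S a).2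
  have hUint : ∀ t (A : Ω → 𝒜), Measurable A →
      Integrable (fun ω => upper g (X.confSet g b t ω) (A ω)) μ := fun t A hA =>
    Integrable.of_bound
      (measurable_comp_fiberwise (hK t) (measurable_upper hg) hA).aestronglyMeasurable C
      (ae_of_all _ fun ω => hupb _ _)
  have hLint : ∀ t (A : Ω → 𝒜), Measurable A →
      Integrable (fun ω => lower g (X.confSet g b t ω) (A ω)) μ := fun t A hA =>
    Integrable.of_bound
      (measurable_comp_fiberwise (hK t) (measurable_lower hg) hA).aestronglyMeasurable C
      (ae_of_all _ fun ω => hlob _ _)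
  have hfint : ∀ A : Ω → 𝒜, Measurable A → Integrable (fun ω => f (X.param ω) (A ω)) μ :=
    fun A hA => Integrable.of_bound
      (measurable_mean hX.measurable_f hX.measurable_param hA).aestronglyMeasurable C
      (ae_of_all _ fun ω => by
        rw [Real.norm_eq_abs, abs_of_nonneg (hfC _ _).1]
        exact (hfC _ _).2)
  let W : ℕ → Ω → ℝ := fun t ω => upper g (X.confSet g b t ω) (X.action t ω) -
    lower g (X.confSet g b t ω) (X.action t ω)
  have hWint : ∀ t, Integrable (W t) μ := fun t =>
    (hUint t _ (hX.measurable_action t)).sub (hLint t _ (hX.measurable_action t))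
  have hbad : ∀ t, MeasurableSet (X.goodEvent f g σ α L x t)ᶜ := fun t =>
    (measurableSet_goodEvent hX hg σ α L x t).compl
  have hstep : ∀ t ∈ Finset.range T,
      ∫ ω, (sSup (f (X.param ω) '' X.actionSet t ω) - f (X.param ω) (X.action t ω)) ∂μ ≤
        (2 * α + 2 * C * (Fintype.card ι * Real.exp (-L) + q)) + ∫ ω, W t ω ∂μ := by
    intro t ht
    have htT := Finset.mem_range.1 ht
    have hbadint : Integrable ((X.goodEvent f g σ α L x t)ᶜ.indicator fun _ => (2 * C)) μ :=
      (integrable_const _).indicator (hbad t)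
    have hI1 : Integrable (fun ω => 2 * α +
        (X.goodEvent f g σ α L x t)ᶜ.indicator (fun _ => (2 * C)) ω) μ :=
      (integrable_const _).add hbadint
    have hI2 : Integrable (fun ω => upper g (X.confSet g b t ω) (Astar t ω) -
        upper g (X.confSet g b t ω) (X.action t ω)) μ :=
      (hUint t _ (hAm t)).sub (hUint t _ (hX.measurable_action t))
    have hI3 : Integrable (fun ω => 2 * α +
        (X.goodEvent f g σ α L x t)ᶜ.indicator (fun _ => (2 * C)) ω +
          (upper g (X.confSet g b t ω) (Astar t ω) -
            upper g (X.confSet g b t ω) (X.action t ω))) μ := hI1.add hI2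
    calc ∫ ω, (sSup (f (X.param ω) '' X.actionSet t ω) - f (X.param ω) (X.action t ω)) ∂μ
        = ∫ ω, (f (X.param ω) (Astar t ω) - f (X.param ω) (X.action t ω)) ∂μ := by
          refine integral_congr_ae ((hAopt t).mono fun ω hω => ?_)
          have : IsGreatest (f (X.param ω) '' X.actionSet t ω) (f (X.param ω) (Astar t ω)) :=
            ⟨⟨_, hω.1, rfl⟩, by rintro _ ⟨a, ha, rfl⟩; exact hω.2 a ha⟩
          simp only [this.csSup_eq]
      _ ≤ ∫ ω, (((2 * α + (X.goodEvent f g σ α L x t)ᶜ.indicator (fun _ => (2 * C)) ω) +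
            (upper g (X.confSet g b t ω) (Astar t ω) -
              upper g (X.confSet g b t ω) (X.action t ω))) + W t ω) ∂μ := by
          refine integral_mono ((hfint _ (hAm t)).sub (hfint _ (hX.measurable_action t)))
            (hI3.add (hWint t)) fun ω => ?_
          simp only [W]
          by_cases hω : ω ∈ X.goodEvent f g σ α L x t
          · obtain ⟨i, hi⟩ := hnet (f (X.param ω)) (hfF ▸ ⟨_, rfl⟩)
            have hmem := mem_confSet_of_mem_goodEvent htT.le hα hω hi
            rw [Set.indicator_of_notMem (Set.notMem_compl_iff.2 hω)]
            have h1 := (abs_le.1 (hi (Astar t ω))).1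
            have h2 := (abs_le.1 (hi (X.action t ω))).2
            have h3 := le_upper (g := g) hmem (Astar t ω)
            have h4 := lower_le (g := g) hmem (X.action t ω)
            linarith
          -- The regret is at most `C` and the envelope terms add up to `U(A*) - L(A) ≥ -C`; hence
          -- the allowance `2C`.
          · rw [Set.indicator_of_mem (Set.mem_compl hω)]
            have h1 := (hfC (X.param ω) (Astar t ω)).2
            have h2 := (hfC (X.param ω) (X.action t ω)).1
            have h3 := (upper_mem_Icc hC hgC (X.confSet g b t ω) (Astar t ω)).1
            have h4 := (lower_mem_Icc hC hgC (X.confSet g b t ω) (X.action t ω)).2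
            linarith
      -- The two integrals of the upper envelope cancel: this is where posterior sampling enters.
      _ = (2 * α + 2 * C * μ.real (X.goodEvent f g σ α L x t)ᶜ) + ∫ ω, W t ω ∂μ := by
          rw [integral_add hI3 (hWint t), integral_add hI1 hI2,
            integral_add (integrable_const _) hbadint,
            integral_sub (hUint t _ (hAm t)) (hUint t _ (hX.measurable_action t)),
            integral_comp_eq_of_condLaw_eq (hX.history_le t)
              (measurableSet_confSet_eq hg b t) (measurable_upper hg) hupb
              (hX.measurable_action t) (hAm t) (hAlaw t),
            integral_indicator_const _ (hbad t)]
          simp [mul_comm]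
      _ ≤ (2 * α + 2 * C * (Fintype.card ι * Real.exp (-L) + q)) + ∫ ω, W t ω ∂μ := by
          gcongr
          refine (measure_goodEvent_compl_le hX hN hσ hg α L x t).trans ?_
          gcongr
          exact hq t htT
  have hwidth : ∀ ω, ∑ t ∈ Finset.range T, W t ω ≤ 1 + d * C + 4 * b * √(d * T) := by
    intro ω
    refine sum_width_le hT hC hb0 hd (fun t => X.action t ω) (fun t => W t ω) ?_ ?_
    · intro t _
      have h1 := (upper_mem_Icc hC hgC (X.confSet g b t ω) (X.action t ω)).2
      have h2 := (lower_mem_Icc hC hgC (X.confSet g b t ω) (X.action t ω)).1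
      simp only [W]
      linarith
    · intro t _ ε hε h
      obtain ⟨i, hi, j, hj, hij⟩ := exists_lt_of_lt_upper_sub_lower hε h
      exact ⟨g i, hgF i, g j, hgF j, sum_sq_le_of_mem_confSet hb0 hi hj, hij⟩
  refine (Finset.sum_le_sum hstep).trans ?_
  rw [Finset.sum_add_distrib, Finset.sum_const, Finset.card_range, nsmul_eq_mul,
    ← integral_finsetSum _ fun t _ => hWint t]
  gcongr
  calc ∫ ω, ∑ t ∈ Finset.range T, W t ω ∂μ ≤ ∫ ω, (1 + d * C + 4 * b * √(d * T)) ∂μ :=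
        integral_mono (integrable_finsetSum _ fun t _ => hWint t) (integrable_const _) hwidth
    _ = 1 + d * C + 4 * b * √(d * T) := by simp

end BanditProcess

/-! ### Covering numbers and Kolmogorov dimension -/

section Covering

variable {𝒜 : Type*} {F : Set (𝒜 → ℝ)}

/-- The centres belong to `F`, so the eluder dimension of `F` controls the differences of net
functions. -/
lemma exists_net {α : ℝ≥0} (h : supCoveringNumber F α ≠ ⊤) :
    ∃ s : Finset (𝒜 → ℝ), (∀ g ∈ s, g ∈ F) ∧ s.card = (supCoveringNumber F α).toNat ∧
      ∀ f ∈ F, ∃ g ∈ s, ∀ a, |g a - f a| ≤ α := by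
  obtain ⟨D, hDF, hDfin, hDcov, hDcard⟩ := Metric.exists_set_encard_eq_coveringNumber h
  refine ⟨(hDfin.toFinset.map UniformFun.toFun.toEmbedding), ?_, ?_, ?_⟩
  · intro g hg
    obtain ⟨u, hu, rfl⟩ := Finset.mem_map.1 hg
    obtain ⟨f, hf, rfl⟩ := hDF (hDfin.mem_toFinset.1 hu)
    exact hf
  · rw [Finset.card_map, supCoveringNumber, ← hDcard, hDfin.encard_eq_coe_toFinset_card]
    rfl
  · intro f hf
    obtain ⟨u, hu, hfu⟩ := hDcov (Set.mem_image_of_mem UniformFun.ofFun hf)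
    refine ⟨UniformFun.toFun u, Finset.mem_map.2 ⟨u, hDfin.mem_toFinset.2 hu, rfl⟩, fun a => ?_⟩
    have h1 : edist (f a) (UniformFun.toFun u a) ≤ α := (UniformFun.edist_eval_le (x := a)).trans hfu
    rw [edist_nndist, ENNReal.coe_le_coe, ← NNReal.coe_le_coe, coe_nndist, dist_comm,
      Real.dist_eq] at h1
    exact h1

lemma eventually_log_supCoveringNumber_le {c : ℝ} (hc : kolmogorovDim F < ENNReal.ofReal c) :
    ∀ᶠ α : ℝ≥0 in 𝓝[>] 0, supCoveringNumber F α ≠ ⊤ ∧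
      Real.log (supCoveringNumber F α).toNat ≤ c * Real.log (1 / α) := by
  have h1 : ∀ᶠ α : ℝ≥0 in 𝓝[>] 0, α < 1 :=
    (eventually_lt_nhds zero_lt_one).filter_mono nhdsWithin_le_nhds
  filter_upwards [eventually_lt_of_limsup_lt hc, h1, self_mem_nhdsWithin] with α hα hα1 hα0
  have hα0' : (0 : ℝ) < α := by exact_mod_cast hα0
  have hlog : 0 < Real.log (1 / α) :=
    Real.log_pos ((one_lt_div hα0').2 (by exact_mod_cast hα1))
  have hc0 : 0 ≤ c := (ENNReal.ofReal_pos.1 (bot_le.trans_lt hc)).le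
  have h2 := (ENNReal.div_le_iff (by simpa using hlog) ENNReal.ofReal_ne_top).1 hα.le
  rw [← ENNReal.ofReal_mul hc0] at h2
  have hne : supCoveringNumber F α ≠ ⊤ := by
    intro h
    rw [h] at h2
    simp at h2
  refine ⟨hne, ?_⟩
  obtain ⟨n, hn⟩ := ENat.ne_top_iff_exists.1 hne
  rw [← hn] at h2 ⊢
  rcases Nat.eq_zero_or_pos n with rfl | hn0
  · simp only [Nat.cast_zero, ENat.toNat_zero, Real.log_zero]
    positivity
  · have h3 : ENNReal.log (((n : ℕ∞) : ℝ≥0∞)) = (Real.log n : EReal) := by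
      rw [ENat.toENNReal_coe, ENNReal.log_pos_real (by simp; omega) (by simp)]
      simp
    rw [h3, EReal.real_coe_toENNReal] at h2
    rw [ENat.toNat_natCast]
    exact (ENNReal.ofReal_le_ofReal_iff (by positivity)).1 h2

/-- The dimension controls small scales only; monotonicity in the scale gives the rest. -/
lemma supCoveringNumber_ne_top (h : kolmogorovDim F ≠ ⊤) {α : ℝ≥0} (hα : 0 < α) :
    supCoveringNumber F α ≠ ⊤ := by
  have hc : kolmogorovDim F < ENNReal.ofReal ((kolmogorovDim F).toReal + 1) :=
    (ENNReal.lt_ofReal_iff_toReal_lt h).2 (lt_add_one _)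
  have h1 : ∀ᶠ β : ℝ≥0 in 𝓝[>] 0, β < α :=
    (eventually_lt_nhds hα).filter_mono nhdsWithin_le_nhds
  obtain ⟨β, hβ, hβα⟩ := ((eventually_log_supCoveringNumber_le hc).and h1).exists
  exact ne_top_of_le_ne_top hβ.1 (Metric.coveringNumber_anti hβα.le)

end Covering

/-- After squaring, the gain `(a' - a) l` must beat `K` and the cross term `2√(a' l)`. -/
lemma eventually_sqrt_add_one_le {a a' K : ℝ} (ha : 0 ≤ a) (haa' : a < a') :
    ∀ᶠ l : ℝ in atTop, √(a * l + K) + 1 ≤ √(a' * l) := by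
  have ha' : 0 < a' := ha.trans_lt haa'
  have hs := Real.tendsto_sqrt_atTop
  filter_upwards [eventually_ge_atTop 0, hs.eventually_ge_atTop 1,
    hs.eventually_ge_atTop ((|K| + 2 * √a') / (a' - a)), hs.eventually_ge_atTop (1 / √a')]
    with l hl h1 h2 h3
  have hsa : 0 < √a' := Real.sqrt_pos.2 ha'
  rw [Real.sqrt_mul ha'.le]
  rw [div_le_iff₀ (sub_pos.2 haa')] at h2
  rw [div_le_iff₀ hsa] at h3
  have h4 : √(a * l + K) ≤ √a' * √l - 1 := by
    rw [Real.sqrt_le_left (by linarith)]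
    have h5 : √l ^ 2 = l := Real.sq_sqrt hl
    have h6 : √a' ^ 2 = a' := Real.sq_sqrt ha'.le
    have h7 : |K| ≤ |K| * √l := le_mul_of_one_le_right (abs_nonneg K) h1
    have h8 := le_abs_self K
    have h9 : (√a' * √l - 1) ^ 2 = a' * l - 2 * (√a' * √l) + 1 := by
      rw [sub_sq, mul_pow, h5, h6]; ring
    have h10 : (|K| + 2 * √a') * √l ≤ √l * (a' - a) * √l := by gcongr
    have h11 : √l * (a' - a) * √l = (a' - a) * l := by rw [mul_right_comm, ← sq, h5, mul_comm]
    nlinarith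
  linarith

/-! ### Choice of the net and of the confidence level -/

namespace BanditProcess

variable {Ω Θ 𝒜 : Type*} [MeasurableSpace Ω] {X : BanditProcess Ω Θ 𝒜} {f : Θ → 𝒜 → ℝ}
  {μ : Measure Ω} [IsProbabilityMeasure μ] {F : Set (𝒜 → ℝ)} {C σ : ℝ}

lemma bayesRegret_le_mul (hC : 0 ≤ C) (hF : ∀ h ∈ F, ∀ a, h a ∈ Set.Icc 0 C)
    (hfF : Set.range f = F) (T : ℕ) : X.bayesRegret f μ T ≤ T * C := by
  have hfC : ∀ ρ a, f ρ a ∈ Set.Icc 0 C := fun ρ => hF _ (hfF ▸ ⟨ρ, rfl⟩)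
  have h : ∀ t ∈ Finset.range T,
      ∫ ω, (sSup (f (X.param ω) '' X.actionSet t ω) - f (X.param ω) (X.action t ω)) ∂μ ≤ C := by
    intro t _
    -- A non-integrable regret has integral 0 by convention.
    by_cases hint : Integrable (fun ω =>
        sSup (f (X.param ω) '' X.actionSet t ω) - f (X.param ω) (X.action t ω)) μ
    · refine (integral_mono hint (integrable_const C) fun ω => ?_).trans (by simp)
      have h1 : sSup (f (X.param ω) '' X.actionSet t ω) ≤ C :=
        Real.sSup_le (by rintro _ ⟨a, -, rfl⟩; exact (hfC _ a).2) hC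
      have h2 := (hfC (X.param ω) (X.action t ω)).1
      simp only
      linarith
    · rw [integral_undef hint]
      exact hC
  exact (Finset.sum_le_sum h).trans (by simp)

variable [MeasurableSpace Θ] [MeasurableSpace 𝒜] {mS : MeasurableSpace (Set 𝒜)} {T d : ℕ}

/-- `F` is its own net, with `α = x = q = 0`. The choice of `L` makes each failure probability at
most `1 / (2T)`, so failures cost `C` in all; the radius is `2σ√(2L)`. -/
lemma bayesRegret_le_of_finite (hC : 0 ≤ C) (hσ : 0 < σ) (hF : ∀ h ∈ F, ∀ a, h a ∈ Set.Icc 0 C)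
    (hfF : Set.range f = F) (hX : X.IsBandit mS f μ) (hN : X.HasSubGaussianNoise mS f μ σ)
    (hPS : X.IsPosteriorSampling mS f μ) (hT : 1 ≤ T) (hd : eluderDim F (T : ℝ)⁻¹ ≤ d)
    (hfin : F.Finite) :
    X.bayesRegret f μ T ≤ 1 + (d + 1) * C +
      8 * σ * √(2 * d * Real.log (2 * F.ncard * T) * T) := by
  have : Fintype F := hfin.fintype
  have hne : F.Nonempty := by
    obtain ⟨ω⟩ := μ.nonempty_of_neZero
    exact hfF ▸ ⟨_, X.param ω, rfl⟩
  have hcard : Fintype.card F = F.ncard := (Nat.card_eq_fintype_card).symm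
  have hn : (0 : ℝ) < F.ncard := by exact_mod_cast (Set.ncard_pos hfin).2 hne
  have hn1 : (1 : ℝ) ≤ F.ncard := by exact_mod_cast (Set.ncard_pos hfin).2 hne
  have hT1 : (1 : ℝ) ≤ T := by exact_mod_cast hT
  set L := Real.log (2 * F.ncard * T) with hL
  have hL0 : 0 ≤ L := Real.log_nonneg (by nlinarith)
  have key := bayesRegret_le_of_net (g := fun i : F => (i : 𝒜 → ℝ)) (α := 0) (L := L) (x := 0)
    (q := 0) hC hσ hF hfF hX hN hPS hT hd (fun i => i.2) le_rfl
    (fun h hh => ⟨⟨h, hh⟩, by simp⟩) (by simp)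
  have hexp : Real.exp (-L) = (2 * F.ncard * T : ℝ)⁻¹ := by
    rw [Real.exp_neg, hL, Real.exp_log (by positivity)]
  rw [hcard, hexp] at key
  refine key.trans (le_of_eq ?_)
  have h1 : √(8 * σ ^ 2 * L + 2 * (T * 0 ^ 2) + 2 * 0) + √T * 0 = 2 * σ * √(2 * L) := by
    rw [show (8 * σ ^ 2 * L + 2 * (T * 0 ^ 2) + 2 * 0 : ℝ) = (2 * σ) ^ 2 * (2 * L) by ring,
      Real.sqrt_mul (sq_nonneg _), Real.sqrt_sq (by positivity)]
    ring
  have h2 : √(2 * d * L * T) = √(2 * L) * √(d * T) := by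
    rw [← Real.sqrt_mul (by positivity)]
    congr 1
    ring
  rw [h1, h2]
  field_simp
  ring

/-- The union bound and the Markov bound on the noise each allow failure probability `1 / (8T)`,
costing `C / 2` over all periods; the approximation error `2αT` is at most another `C / 2`. -/
lemma bayesRegret_le_of_supCoveringNumber (hC : 0 < C) (hσ : 0 < σ)
    (hF : ∀ h ∈ F, ∀ a, h a ∈ Set.Icc 0 C)
    (hfF : Set.range f = F) (hX : X.IsBandit mS f μ) (hN : X.HasSubGaussianNoise mS f μ σ)
    (hPS : X.IsPosteriorSampling mS f μ) (hT : 1 ≤ T) (hd : eluderDim F (T : ℝ)⁻¹ ≤ d) {α : ℝ≥0}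
    (hα : 0 < α) (hαT : 4 * (α * T) ≤ C) (hcov : supCoveringNumber F α ≠ ⊤) :
    X.bayesRegret f μ T ≤ 1 + (d + 1) * C +
      4 * (√(8 * σ ^ 2 * (Real.log (8 * T) + Real.log (supCoveringNumber F α).toNat) +
        2 * (T * α ^ 2) + 2 * (32 * (α * T ^ 2) * Real.exp (σ ^ 2 / 2))) + √T * α) *
          √(d * T) := by
  obtain ⟨s, hsF, hscard, hsnet⟩ := exists_net hcov
  have hα' : (0 : ℝ) < α := hα
  have hT0 : (0 : ℝ) < T := by exact_mod_cast hT
  have hs : s.Nonempty := by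
    obtain ⟨ω⟩ := μ.nonempty_of_neZero
    obtain ⟨g, hg, -⟩ := hsnet (f (X.param ω)) (hfF ▸ ⟨_, rfl⟩)
    exact ⟨g, hg⟩
  have hn : (0 : ℝ) < s.card := by exact_mod_cast hs.card_pos
  rw [← hscard]
  set e := Real.exp (σ ^ 2 / 2) with he
  have he0 : 0 < e := Real.exp_pos _
  have hq : ∀ t < T, μ.real {ω | 32 * (α * T ^ 2) * e <
      2 * (α : ℝ) * ∑ k ∈ Finset.range t, |X.noise f k ω|} ≤ 1 / (8 * T) := by
    intro t ht
    have hset : {ω | 32 * (α * T ^ 2) * e < 2 * (α : ℝ) * ∑ k ∈ Finset.range t, |X.noise f k ω|} =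
        {ω | 16 * T ^ 2 * e < ∑ k ∈ Finset.range t, |X.noise f k ω|} := by
      ext ω
      simp only [Set.mem_ofPred_eq]
      rw [show 32 * (α * T ^ 2) * e = 2 * (α : ℝ) * (16 * T ^ 2 * e) by ring,
        mul_lt_mul_iff_right₀ (by positivity)]
    rw [hset]
    refine (measure_lt_sum_abs_noise hX hN t (by positivity)).trans ?_
    have htT : (t : ℝ) ≤ T := by exact_mod_cast ht.le
    rw [div_le_div_iff₀ (by positivity) (by positivity)]
    calc t * (2 * e) * (8 * T) ≤ T * (2 * e) * (8 * T) := by gcongr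
      _ = 1 * (16 * T ^ 2 * e) := by ring
  have key := bayesRegret_le_of_net (g := fun i : s => (i : 𝒜 → ℝ))
    (L := Real.log (8 * T) + Real.log s.card) hC.le hσ hF hfF hX hN hPS hT hd
    (fun i => hsF i i.2) hα'.le (fun h hh => by
      obtain ⟨g, hg, hgh⟩ := hsnet h hh
      exact ⟨⟨g, hg⟩, hgh⟩) hq
  refine key.trans ?_
  have hexp : Real.exp (-(Real.log (8 * T) + Real.log s.card)) = (8 * T * s.card : ℝ)⁻¹ := by
    rw [Real.exp_neg, Real.exp_add, Real.exp_log (by positivity), Real.exp_log hn]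
  rw [hexp, Fintype.card_coe]
  have h1 : (T : ℝ) * (2 * α + 2 * C * (s.card * (8 * T * s.card : ℝ)⁻¹ + 1 / (8 * T))) =
      2 * (α * T) + C / 2 := by
    field_simp
    ring
  rw [h1]
  linarith

end BanditProcess

/-! ### Asymptotics of the radius and the sequence `h` -/

/-- For large horizons, the radius of the confidence sets is governed by the Kolmogorov dimension. -/
lemma eventually_radius_le {𝒜 : Type*} {F : Set (𝒜 → ℝ)} {σ : ℝ} (hσ : 0 < σ)
    (h : kolmogorovDim F ≠ ⊤) :
    ∀ᶠ T : ℕ in atTop,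
      √(8 * σ ^ 2 * (Real.log (8 * T) +
            Real.log (supCoveringNumber F ((T : ℝ≥0) ^ 2)⁻¹).toNat) +
          2 * (T * (((T : ℝ≥0) ^ 2)⁻¹ : ℝ≥0) ^ 2) +
          2 * (32 * ((((T : ℝ≥0) ^ 2)⁻¹ : ℝ≥0) * T ^ 2) * Real.exp (σ ^ 2 / 2))) +
        √T * (((T : ℝ≥0) ^ 2)⁻¹ : ℝ≥0) ≤
      4 * σ * √((1 + (kolmogorovDim F).toReal) * Real.log T) := by
  set κ := (kolmogorovDim F).toReal with hκ
  have hκ0 : 0 ≤ κ := ENNReal.toReal_nonneg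
  have hc : kolmogorovDim F < ENNReal.ofReal (κ + 1 / 4) :=
    (ENNReal.lt_ofReal_iff_toReal_lt h).2 (by linarith)
  have hα : Tendsto (fun T : ℕ => ((T : ℝ≥0) ^ 2)⁻¹) atTop (𝓝[>] 0) := by
    refine tendsto_inv_atTop_nhdsGT_zero.comp ?_
    exact (tendsto_pow_atTop two_ne_zero).comp tendsto_natCast_atTop_atTop
  have hlog : Tendsto (fun T : ℕ => Real.log T) atTop atTop :=
    Real.tendsto_log_atTop.comp tendsto_natCast_atTop_atTop
  -- As `log (1 / α) = 2 log T`, the net costs `(2κ + 1/2) log T` and the confidence level another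
  -- `log T`. The target `16σ²(1 + κ)` leaves a spare `4σ² log T`, which absorbs all bounded terms.
  have hmain := hlog.eventually (eventually_sqrt_add_one_le
    (a := 8 * σ ^ 2 * (3 / 2 + 2 * κ)) (a' := 8 * σ ^ 2 * (2 + 2 * κ))
    (K := 8 * σ ^ 2 * Real.log 8 + 2 + 2 * (32 * Real.exp (σ ^ 2 / 2))) (by positivity)
    (by have : 0 < σ ^ 2 := by positivity
        nlinarith))
  filter_upwards [hmain, hα.eventually (eventually_log_supCoveringNumber_le hc),
    eventually_ge_atTop 1] with T hT hcov hT1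
  have hT1' : (1 : ℝ) ≤ T := by exact_mod_cast hT1
  have hT0 : (0 : ℝ) < T := by linarith
  push_cast at hcov ⊢
  have h1 : ((T : ℝ) ^ 2)⁻¹ * T ^ 2 = 1 := inv_mul_cancel₀ (by positivity)
  have h2 : (T : ℝ) * (((T : ℝ) ^ 2)⁻¹) ^ 2 ≤ 1 := by
    rw [show (T : ℝ) * (((T : ℝ) ^ 2)⁻¹) ^ 2 = ((T : ℝ) ^ 3)⁻¹ by field_simp]
    exact inv_le_one_of_one_le₀ (one_le_pow₀ hT1')
  have h3 : √T * ((T : ℝ) ^ 2)⁻¹ ≤ 1 := by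
    rw [← div_eq_mul_inv, div_le_one (by positivity)]
    exact (Real.sqrt_le_left (by positivity)).2 (by
      rw [← pow_mul]
      exact le_self_pow₀ hT1' (by norm_num))
  have h4 : Real.log (1 / ((T : ℝ) ^ 2)⁻¹) = 2 * Real.log T := by
    rw [one_div, inv_inv, Real.log_pow]
    norm_num
  have h5 := hcov.2
  rw [h4] at h5
  have h6 : 4 * σ * √((1 + κ) * Real.log T) = √(8 * σ ^ 2 * (2 + 2 * κ) * Real.log T) := by
    rw [show 8 * σ ^ 2 * (2 + 2 * κ) * Real.log T = (4 * σ) ^ 2 * ((1 + κ) * Real.log T) by ring,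
      Real.sqrt_mul (sq_nonneg _), Real.sqrt_sq (by positivity)]
  rw [h6]
  refine le_trans (add_le_add (Real.sqrt_le_sqrt ?_) h3) hT
  rw [h1, Real.log_mul (by norm_num) hT0.ne', mul_one]
  have h7 : 8 * σ ^ 2 * (Real.log 8 + Real.log T +
      Real.log (supCoveringNumber F ((T : ℝ≥0) ^ 2)⁻¹).toNat) ≤
      8 * σ ^ 2 * (Real.log 8 + Real.log T + (κ + 1 / 4) * (2 * Real.log T)) := by gcongr
  linarith

lemma ofReal_regret_bound {C σ c B : ℝ} (hC : 0 ≤ C) (hσ : 0 ≤ σ) (hc : 0 ≤ c) (hB : 0 ≤ B)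
    (d : ℕ) :
    ENNReal.ofReal (1 + (d + 1) * C + c * σ * √B) =
      1 + ((d : ℝ≥0∞) + 1) * ENNReal.ofReal C +
        ENNReal.ofReal c * ENNReal.ofReal σ * ENNReal.ofReal B ^ (1 / 2 : ℝ) := by
  rw [ENNReal.ofReal_add (by positivity) (by positivity),
    ENNReal.ofReal_add (by positivity) (by positivity), ENNReal.ofReal_mul (by positivity),
    ENNReal.ofReal_mul (by positivity), ENNReal.ofReal_mul hc,
    ENNReal.ofReal_rpow_of_nonneg hB (by positivity), ← Real.sqrt_eq_rpow,
    ENNReal.ofReal_add (by positivity) zero_le_one, ENNReal.ofReal_natCast, ENNReal.ofReal_one]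

/-- A correction term for small horizons that makes the regret bound trivial. -/
noncomputable def smallHorizonTerm (C σ : ℝ) (T₀ T : ℕ) : ℝ≥0 :=
  if T < T₀ then Real.toNNReal (C ^ 2 * T / σ ^ 2) else 0

lemma tendsto_smallHorizonTerm (C σ : ℝ) (T₀ : ℕ) :
    Tendsto (smallHorizonTerm C σ T₀) atTop (𝓝 0) :=
  tendsto_const_nhds.congr' <| (eventually_ge_atTop T₀).mono fun T hT => by
    simp [smallHorizonTerm, not_lt.2 hT]

/-- Regret bound in terms of a finite Kolmogorov dimension. -/
lemma exists_horizon_bayesRegret_le {𝒜 : Type*} [MeasurableSpace 𝒜] {F : Set (𝒜 → ℝ)} {C σ : ℝ}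
    (hC : 0 < C) (hσ : 0 < σ) (hF : ∀ g ∈ F, ∀ a, g a ∈ Set.Icc 0 C) (hk : kolmogorovDim F ≠ ⊤) :
    ∃ T₀ : ℕ, ∀ (Ω Θ : Type*) [MeasurableSpace Ω] [MeasurableSpace Θ]
      (mS : MeasurableSpace (Set 𝒜)) (μ : Measure Ω) [IsProbabilityMeasure μ] (f : Θ → 𝒜 → ℝ)
      (X : BanditProcess Ω Θ 𝒜), Set.range f = F → X.IsBandit mS f μ →
      X.HasSubGaussianNoise mS f μ σ → X.IsPosteriorSampling mS f μ →
      ∀ T d : ℕ, 1 ≤ T → eluderDim F (T : ℝ)⁻¹ = d →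
        X.bayesRegret f μ T ≤ 1 + (d + 1) * C + 16 * σ *
          √(d * (1 + smallHorizonTerm C σ T₀ T + (kolmogorovDim F).toReal) * Real.log T * T) := by
  obtain ⟨T₀, hT₀⟩ := eventually_atTop.1 ((eventually_gt_atTop 1).and
    ((tendsto_natCast_atTop_atTop.eventually_ge_atTop (4 / C)).and (eventually_radius_le hσ hk)))
  refine ⟨T₀, fun Ω Θ _ _ mS μ _ f X hfF hX hN hPS T d hT hd => ?_⟩
  have hT1 : (1 : ℝ) ≤ T := by exact_mod_cast hT
  have hTpos : (0 : ℝ) < T := by linarith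
  have htriv := X.bayesRegret_le_mul (μ := μ) hC.le hF hfF T
  set κ := (kolmogorovDim F).toReal with hκ
  have hκ0 : 0 ≤ κ := ENNReal.toReal_nonneg
  have hlog0 : 0 ≤ Real.log T := Real.log_nonneg hT1
  by_cases hTT₀ : T < T₀
  · rcases hT.eq_or_lt with rfl | hT2
    · refine htriv.trans ?_
      have h0 : 0 ≤ (d : ℝ) * C := by positivity
      simp only [Nat.cast_one, Real.log_one, mul_zero, zero_mul, Real.sqrt_zero, add_zero]
      linarith
    -- With `d = 0` the root vanishes whatever `h` is, so the trivial bound does not suffice. The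
    -- net bound at scale `C / (4T)` gives `1 + C`, its own root vanishing too.
    rcases Nat.eq_zero_or_pos d with rfl | hd0
    · have hα : (0 : ℝ) < C / (4 * T) := by positivity
      have := BanditProcess.bayesRegret_le_of_supCoveringNumber hC hσ hF hfF hX hN hPS hT hd.le
        (Real.toNNReal_pos.2 hα) (by rw [Real.coe_toNNReal _ hα.le]; field_simp; rfl)
        (supCoveringNumber_ne_top hk (Real.toNNReal_pos.2 hα))
      simpa using this
    · refine htriv.trans ?_
      have hterm : (smallHorizonTerm C σ T₀ T : ℝ) = C ^ 2 * T / σ ^ 2 := by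
        rw [smallHorizonTerm, if_pos hTT₀, Real.coe_toNNReal _ (by positivity)]
      have hlog : 1 / 2 ≤ Real.log T := by
        have h2 : Real.log 2 ≤ Real.log T :=
          Real.log_le_log (by norm_num) (by exact_mod_cast hT2)
        linarith [Real.log_two_gt_d9]
      have hd1 : (1 : ℝ) ≤ d := by exact_mod_cast hd0
      have h1 : C * T / (16 * σ) ≤
          √(d * (1 + smallHorizonTerm C σ T₀ T + κ) * Real.log T * T) := by
        refine Real.le_sqrt_of_sq_le ?_
        rw [hterm]
        calc (C * T / (16 * σ)) ^ 2 = 1 / 256 * (C ^ 2 * T / σ ^ 2) * T := by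
              field_simp
              norm_num
          _ ≤ 1 / 2 * (C ^ 2 * T / σ ^ 2) * T := by gcongr; norm_num
          _ = 1 * (0 + C ^ 2 * T / σ ^ 2 + 0) * (1 / 2) * T := by ring
          _ ≤ d * (1 + C ^ 2 * T / σ ^ 2 + κ) * Real.log T * T := by gcongr; norm_num
      rw [div_le_iff₀ (by positivity)] at h1
      have h0 : 0 ≤ ((d : ℝ) + 1) * C := by positivity
      linarith
  · obtain ⟨hT2, hTC, hrad⟩ := hT₀ T (not_lt.1 hTT₀)
    have hα : (0 : ℝ≥0) < ((T : ℝ≥0) ^ 2)⁻¹ := by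
      have : (0 : ℝ≥0) < T := by exact_mod_cast hT
      positivity
    have key := BanditProcess.bayesRegret_le_of_supCoveringNumber hC hσ hF hfF hX hN hPS hT hd.le
      hα (by
        push_cast
        rw [div_le_iff₀ hC] at hTC
        rw [show (4 : ℝ) * (((T : ℝ) ^ 2)⁻¹ * T) = 4 / T by field_simp, div_le_iff₀ hTpos]
        linarith) (supCoveringNumber_ne_top hk hα)
    refine key.trans ?_
    have hterm : (smallHorizonTerm C σ T₀ T : ℝ) = 0 := by
      rw [smallHorizonTerm, if_neg hTT₀, NNReal.coe_zero]
    have hsqrt : √(d * (1 + 0 + κ) * Real.log T * T) =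
        √((1 + κ) * Real.log T) * √(d * T) := by
      rw [← Real.sqrt_mul (by positivity)]
      congr 1
      ring
    rw [hterm, hsqrt, show 16 * σ * (√((1 + κ) * Real.log T) * √(d * T)) =
      4 * (4 * σ * √((1 + κ) * Real.log T)) * √(d * T) by ring]
    gcongr

end PosteriorSampling


/-! ### Assembly, with infinite dimensions -/

theorem mainTheorem1 {𝒜 : Type*} [MeasurableSpace 𝒜] (F : Set (𝒜 → ℝ)) (C σ : ℝ)
    (hC : 0 < C) (hσ : 0 < σ) (hF : ∀ g ∈ F, ∀ a, g a ∈ Set.Icc 0 C) :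
    ∃ h : ℕ → ℝ≥0, Tendsto h atTop (𝓝 0) ∧
      ∀ (Ω Θ : Type*) [MeasurableSpace Ω] [MeasurableSpace Θ] (mS : MeasurableSpace (Set 𝒜))
        (μ : Measure Ω) [IsProbabilityMeasure μ] (f : Θ → 𝒜 → ℝ)
        (X : PosteriorSampling.BanditProcess Ω Θ 𝒜),
        Set.range f = F → X.IsBandit mS f μ → X.HasSubGaussianNoise mS f μ σ →
        X.IsPosteriorSampling mS f μ →
        ∀ T : ℕ, 1 ≤ T →
          (PosteriorSampling.eluderDim F (T : ℝ)⁻¹ ≠ 0 ∨ PosteriorSampling.kolmogorovDim F ≠ ⊤ →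
            ENNReal.ofReal (X.bayesRegret f μ T) ≤
              1 + ((PosteriorSampling.eluderDim F (T : ℝ)⁻¹ : ℝ≥0∞) + 1) * ENNReal.ofReal C +
                16 * ENNReal.ofReal σ *
                  ((PosteriorSampling.eluderDim F (T : ℝ)⁻¹ : ℝ≥0∞) *
                    (1 + h T + PosteriorSampling.kolmogorovDim F) *
                    ENNReal.ofReal (Real.log T) * T) ^ (1 / 2 : ℝ)) ∧
          (F.Finite →
            ENNReal.ofReal (X.bayesRegret f μ T) ≤
              1 + ((PosteriorSampling.eluderDim F (T : ℝ)⁻¹ : ℝ≥0∞) + 1) * ENNReal.ofReal C +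
                8 * ENNReal.ofReal σ *
                  (2 * (PosteriorSampling.eluderDim F (T : ℝ)⁻¹ : ℝ≥0∞) *
                    ENNReal.ofReal (Real.log (2 * F.ncard * T)) * T) ^ (1 / 2 : ℝ)) := by
  -- `h` is fixed before the probability space; if the Kolmogorov dimension is infinite, `h = 0`
  -- serves.
  have hex : ∃ h : ℕ → ℝ≥0, Tendsto h atTop (𝓝 0) ∧ (PosteriorSampling.kolmogorovDim F ≠ ⊤ →
      ∀ (Ω Θ : Type _) [MeasurableSpace Ω] [MeasurableSpace Θ]
      (mS : MeasurableSpace (Set 𝒜)) (μ : Measure Ω) [IsProbabilityMeasure μ] (f : Θ → 𝒜 → ℝ)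
      (X : PosteriorSampling.BanditProcess Ω Θ 𝒜), Set.range f = F → X.IsBandit mS f μ →
      X.HasSubGaussianNoise mS f μ σ → X.IsPosteriorSampling mS f μ →
      ∀ T d : ℕ, 1 ≤ T → PosteriorSampling.eluderDim F (T : ℝ)⁻¹ = d →
        X.bayesRegret f μ T ≤ 1 + (d + 1) * C + 16 * σ *
          √(d * (1 + h T + (PosteriorSampling.kolmogorovDim F).toReal) * Real.log T * T)) := by
    by_cases hk : PosteriorSampling.kolmogorovDim F = ⊤
    · exact ⟨0, tendsto_const_nhds, fun h => absurd hk h⟩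
    · obtain ⟨T₀, h⟩ := PosteriorSampling.exists_horizon_bayesRegret_le hC hσ hF hk
      exact ⟨_, PosteriorSampling.tendsto_smallHorizonTerm C σ T₀, fun _ => h⟩
  obtain ⟨h, hlim, hbound⟩ := hex
  refine ⟨h, hlim, fun Ω Θ _ _ mS μ _ f X hfF hX hN hPS T hT => ?_⟩
  have hT1 : (1 : ℝ) ≤ T := by exact_mod_cast hT
  have hCne : ENNReal.ofReal C ≠ 0 := by simpa using hC
  by_cases hd : PosteriorSampling.eluderDim F (T : ℝ)⁻¹ = ⊤
  · simp [hd, ENNReal.top_mul hCne]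
  obtain ⟨d, hd⟩ := ENat.ne_top_iff_exists.1 hd
  rw [← hd, ENat.toENNReal_coe]
  refine ⟨fun hcase => ?_, fun hfin => ?_⟩
  · by_cases hk : PosteriorSampling.kolmogorovDim F = ⊤
    · rcases hT.eq_or_lt with rfl | hT2
      · calc ENNReal.ofReal (X.bayesRegret f μ 1) ≤ ENNReal.ofReal C := by
              simpa using ENNReal.ofReal_le_ofReal (X.bayesRegret_le_mul (μ := μ) hC.le hF hfF 1)
          _ ≤ 1 + ((d : ℝ≥0∞) + 1) * ENNReal.ofReal C := by
              rw [add_mul, one_mul, ← add_assoc]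
              exact le_add_self
          _ ≤ _ := le_self_add
      · have hd0 : (d : ℝ≥0∞) ≠ 0 := by
          rcases hcase with h | h
          · exact_mod_cast h
          · exact absurd hk h
        have hlog : ENNReal.ofReal (Real.log T) ≠ 0 := by
          have := Real.log_pos (show (1 : ℝ) < T by exact_mod_cast hT2)
          simpa using this
        have hTne : (T : ℝ≥0∞) ≠ 0 := by
          simp only [ne_eq, Nat.cast_eq_zero]
          omega
        rw [hk, add_top, ENNReal.mul_top hd0, ENNReal.top_mul hlog, ENNReal.top_mul hTne,
          ENNReal.top_rpow_of_pos (by norm_num), ENNReal.mul_top (by simpa using hσ), add_top]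
        exact le_top
    · have key := ENNReal.ofReal_le_ofReal
        (hbound hk Ω Θ mS μ f X hfF hX hN hPS T d hT hd.symm)
      have hlog0 : 0 ≤ Real.log T := Real.log_nonneg hT1
      rw [PosteriorSampling.ofReal_regret_bound hC.le hσ.le (by norm_num) (by positivity),
        ENNReal.ofReal_mul (by positivity), ENNReal.ofReal_mul (by positivity),
        ENNReal.ofReal_mul (by positivity), ENNReal.ofReal_add (by positivity) (by positivity),
        ENNReal.ofReal_add (by positivity) (by positivity), ENNReal.ofReal_toReal hk] at key
      simpa using key
  · have key := ENNReal.ofReal_le_ofReal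
      (PosteriorSampling.BanditProcess.bayesRegret_le_of_finite hC.le hσ hF hfF hX hN hPS hT
        hd.symm.le hfin)
    have hn : (1 : ℝ) ≤ F.ncard := by
      obtain ⟨ω⟩ := μ.nonempty_of_neZero
      exact_mod_cast (Set.ncard_pos hfin).2 (hfF ▸ ⟨_, X.param ω, rfl⟩)
    have hlog0 : 0 ≤ Real.log (2 * F.ncard * T) := Real.log_nonneg (by nlinarith)
    rw [PosteriorSampling.ofReal_regret_bound hC.le hσ.le (by norm_num) (by positivity),
      ENNReal.ofReal_mul (by positivity), ENNReal.ofReal_mul (by positivity),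
      ENNReal.ofReal_mul (by positivity)] at key
    simpa using key
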